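/- **Setting.** Let $\mathcal M$ be a smooth, connected, finite-dimensional Riemannian manifold with geodesic distance $d$, and let $\mathcal X\subseteq\mathcal M$ be compact and geodesically convex: any $x,y\in\mathcal X$ are joined by exactly one minimizing geodesic $\gamma_{xy}:[0,1]\to\mathcal M$, and it stays in $\mathcal X$. For $x,y\in\mathcal X$ write $\mathrm{Exp}_x^{-1}(y)=\dot\gamma_{xy}(0)\in T_x\mathcal M$ and let $\Gamma_x^y:T_x\mathcal M\to T_y\mathcal M$ be the (Levi-Civita) parallel transport along $\gamma_{xy}$. Let $\Phi=\frac1m\sum_{i=1}^m\phi_i$ with $m\ge 1$, where each $\phi_i:\mathcal M\to\mathbb R$ is differentiable at the points of $\mathcal X$ and $L$-smooth on $\mathcal X$: $\|\mathrm{grad}\,\phi_i(y)-\Gamma_x^y\,\mathrm{grad}\,\phi_i(x)\|\le L\,d(x,y)$ for all $x,y\in\mathcal X$ (the $\phi_i$ may be nonconvex). The incremental first-order oracle (IFO) returns $(\phi_i(x),\mathrm{grad}\,\phi_i(x))$ on input $(i,x)$; the Riemannian linear optimization oracle (RLO) returns an element of $\operatorname{argmin}_{z\in\mathcal X}\langle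 g,\mathrm{Exp}_x^{-1}(z)\rangle$ on input $(x,g)$ with $x\in\mathcal X$, $g\in T_x\mathcal M$. The Frank-Wolfe gap is $\mathcal G(x)=\max_{y\in\mathcal X}\langle \mathrm{Exp}_x^{-1}(y),-\mathrm{grad}\,\Phi(x)\rangle$. **Algorithm (SVR-RFW).** Parameters: number of epochs $S\ge1$, epoch length $K$, minibatch size $b$, step size $\eta$, starting point $\tilde x^0\in\mathcal X$. For $s=0,\dots,S-1$: query the IFO for $\mathrm{grad}\,\phi_i(\tilde x^s)$, $i=1,\dots,m$, form $\mathrm{grad}\,\Phi(\tilde x^s)$ and put $x_0^{s+1}=\tilde x^s$; for $k=0,\dots,K-1$ draw indices $i_1,\dots,i_b$ independently and uniformly from $\{1,\dots,m\}$, form $$g_k=\frac1b\sum_{l=1}^b\Big(\mathrm{grad}\,\phi_{i_l}(x_k^{s+1})-\Gamma_{\tilde x^s}^{x_k^{s+1}}\big(\mathrm{grad}\,\phi_{i_l}(\tilde x^s)-\mathrm{grad}\,\Phi(\tilde x^s)\big)\Big),$$ let $z$ be the answer of the RLO to $(x_k^{s+1},g_k)$ and put $x_{k+1}^{s+1}=\gamma_{x_k^{s+1}z}(\eta)$;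 then put $\tilde x^{s+1}=x_K^{s+1}$. The output $\hat x$ is chosen uniformly at random from the $KS$ iterates $x_k^{s+1}$, $0\le k<K$, $0\le s<S$. The output is called an $\varepsilon$-accurate solution if $\mathbb E[\mathcal G(\hat x)]\le\varepsilon$. **Statement.** For all real $L,D,\Delta$ there is a constant $C>0$, depending only on $L,D,\Delta$, such that for all $m\ge1$ and $\varepsilon>0$ there is a number of epochs $S\ge1$, depending only on $L,D,\Delta,m,\varepsilon$, with the following property. Whenever $\mathcal M,\mathcal X,\phi_1,\dots,\phi_m,\tilde x^0$ are as above with $\mathrm{diam}(\mathcal X)\le D$ and $\Phi(\tilde x^0)-\min_{\mathcal X}\Phi\le\Delta$, SVR-RFW with epoch length $K=\lceil m^{1/3}\rceil$, $S$ epochs, minibatch size $b=K^2$ and step size $\eta=1/\sqrt{KS}$ outputs an $\varepsilon$-accurate solution, and every run of it makes * at most $C\,(m+m^{2/3}/\varepsilon^2)$ IFO calls, and * at most $C\,(m^{1/3}+1/\varepsilon^2)$ RLO calls, and in fact at most $C/\varepsilon^2$ RLO calls as soon as $m^{1/3}\le 1/\varepsilon^2$ (so the number of RLO calls is $O(1/\varepsilon^2)$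 as $\varepsilon\to0$, with a constant independent of $m$). -/

import Mathlib

open Set Manifold Bundle
open scoped ContDiff ENNReal

noncomputable section

/-! ### Riemannian geometry: gradient, parallel fields, geodesics, inverse exponential map -/

section Geometry

variable {E : Type*} [NormedAddCommGroup E] [NormedSpace ℝ E] [FiniteDimensional ℝ E]
  {M : Type*} [MetricSpace M] [ChartedSpace E M] [IsManifold 𝓘(ℝ, E) ∞ M]
  [RiemannianBundle (fun x : M => TangentSpace 𝓘(ℝ, E) x)]

variable (E) in
/-- The velocity `γ'(t)` of a curve parametrized by `[0, 1]` (one-sided at the end points). -/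
def velocity (γ : ℝ → M) (t : ℝ) : TangentSpace 𝓘(ℝ, E) (γ t) :=
  mfderivWithin 𝓘(ℝ, ℝ) 𝓘(ℝ, E) γ (Icc 0 1) t (1 : ℝ)

/-- The inner product `⟨u, v⟩_p` of two tangent vectors at `p`. -/
def metricAt (p : M) (u v : TangentSpace 𝓘(ℝ, E) p) : ℝ := inner ℝ u v

/-- The Riemannian metric `g_y(u, v)` read in the preferred chart at `p`: here `y` lies in the
target of that chart and `u`, `v` are coordinate vectors in that chart. -/
def metricInChart (p : M) (y u v : E) : ℝ :=
  let q : M := (extChartAt 𝓘(ℝ, E) p).symm y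
  metricAt (E := E) q (tangentCoordChange 𝓘(ℝ, E) p q q u) (tangentCoordChange 𝓘(ℝ, E) p q q v)

/-- The derivative at `p`, in the direction `a`, of the coefficient `g(u, v)` of the metric in the
preferred chart at `p`. -/
def metricDeriv (p : M) (a u v : E) : ℝ :=
  fderiv ℝ (fun y : E => metricInChart p y u v) (extChartAt 𝓘(ℝ, E) p p) a

/-- The Christoffel symbol of the first kind at `p`, contracted with `u`, `v`, `w`, in the preferred
chart at `p`: this is `g(Γ(u, v), w)` for the Levi-Civita connection. -/
def christoffel (p : M) (u v w : E) : ℝ :=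
  (metricDeriv p u v w + metricDeriv p v u w - metricDeriv p w u v) / 2

/-- The coordinates, in the preferred chart at `p`, of a vector field along a curve. -/
def coordAlong (γ : ℝ → M) (V : (t : ℝ) → TangentSpace 𝓘(ℝ, E) (γ t)) (p : M) (s : ℝ) : E :=
  tangentCoordChange 𝓘(ℝ, E) (γ s) p (γ s) (V s)

/-- `V` is parallel along `γ : [0, 1] → M` for the Levi-Civita connection: at every time `t`,
in the chart at `γ t`, `g(V' + Γ(γ', V), w) = 0` for all `w`. -/
def IsParallelAlong (γ : ℝ → M) (V : (t : ℝ) → TangentSpace 𝓘(ℝ, E) (γ t)) : Prop :=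
  ∀ t ∈ Icc (0 : ℝ) 1,
    DifferentiableWithinAt ℝ (coordAlong (E := E) γ V (γ t)) (Icc 0 1) t ∧
    ∀ w : E,
      let V' : E := derivWithin (coordAlong (E := E) γ V (γ t)) (Icc 0 1) t
      metricAt (E := E) (γ t) V' w + christoffel (E := E) (γ t) (velocity E γ t) (V t) w = 0

variable (E) in
/-- A geodesic parametrized by `[0, 1]`: a smooth curve whose velocity field is parallel. -/
def IsGeodesic (γ : ℝ → M) : Prop :=
  ContMDiffOn 𝓘(ℝ, ℝ) 𝓘(ℝ, E) ∞ γ (Icc 0 1) ∧ IsParallelAlong γ (velocity E γ)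

variable (E) in
/-- `γ : [0, 1] → M` is a geodesic from `x` to `y` whose length is the distance of `x` and `y`. -/
def IsMinimizingGeodesic (x y : M) (γ : ℝ → M) : Prop :=
  IsGeodesic E γ ∧ γ 0 = x ∧ γ 1 = y ∧ pathELength 𝓘(ℝ, E) γ 0 1 = edist x y

variable (E) in
/-- Any two points of `X` are joined by exactly one minimizing geodesic of `M`, and it stays in
`X`. -/
def IsGeodesicallyConvex (X : Set M) : Prop :=
  ∀ x ∈ X, ∀ y ∈ X, ∃ γ : ℝ → M, IsMinimizingGeodesic E x y γ ∧
    (∀ t ∈ Icc (0 : ℝ) 1, γ t ∈ X) ∧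
    ∀ γ' : ℝ → M, IsMinimizingGeodesic E x y γ' → EqOn γ' γ (Icc 0 1)

open Classical in
variable (E) in
/-- The geodesic map: the minimizing geodesic from `x` to `y` (a constant curve if there is
none). -/
def geodesicMap (x y : M) : ℝ → M :=
  if h : ∃ γ : ℝ → M, IsMinimizingGeodesic E x y γ then h.choose else fun _ => x

variable (E) in
/-- The inverse exponential map `Exp_x⁻¹(y)`: the initial velocity of the minimizing geodesic from
`x` to `y`. -/
def expInv (x y : M) : TangentSpace 𝓘(ℝ, E) x := velocity E (geodesicMap E x y) 0

/-- `w` is the parallel transport of `v` along the minimizing geodesic from `x` to `y`. -/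
def IsParallelTransport (x y : M) (v : TangentSpace 𝓘(ℝ, E) x) (w : TangentSpace 𝓘(ℝ, E) y) :
    Prop :=
  ∃ V : (t : ℝ) → TangentSpace 𝓘(ℝ, E) (geodesicMap E x y t),
    IsParallelAlong (geodesicMap E x y) V ∧ V 0 = v ∧ V 1 = w

open Classical in
/-- The parallel transport operator from `x` to `y`. -/
def parallelTransport (x y : M) (v : TangentSpace 𝓘(ℝ, E) x) : TangentSpace 𝓘(ℝ, E) y :=
  if h : ∃ w : TangentSpace 𝓘(ℝ, E) y, IsParallelTransport x y v w then h.choose else 0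

variable (E) in
/-- The Riemannian gradient: the Riesz representative of the differential. -/
def riemGrad (f : M → ℝ) (x : M) : TangentSpace 𝓘(ℝ, E) x :=
  haveI : FiniteDimensional ℝ (TangentSpace 𝓘(ℝ, E) x) := inferInstanceAs (FiniteDimensional ℝ E)
  haveI : CompleteSpace (TangentSpace 𝓘(ℝ, E) x) := FiniteDimensional.complete ℝ _
  (InnerProductSpace.toDual ℝ (TangentSpace 𝓘(ℝ, E) x)).symm (mfderiv 𝓘(ℝ, E) 𝓘(ℝ, ℝ) f x)

variable (E) in
/-- `f` is differentiable at the points of `X`, with `L`-Lipschitz gradient there: gradients at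
`x` and `y` are compared through the (existing and unique) parallel transport from `x` to `y`. -/
def IsLSmoothOn (X : Set M) (L : ℝ) (f : M → ℝ) : Prop :=
  (∀ x ∈ X, MDifferentiableAt 𝓘(ℝ, E) 𝓘(ℝ, ℝ) f x) ∧
  ∀ x ∈ X, ∀ y ∈ X, ∃ w : TangentSpace 𝓘(ℝ, E) y,
    IsParallelTransport x y (riemGrad E f x) w ∧ ‖riemGrad E f y - w‖ ≤ L * dist x y

variable (E) in
/-- The Frank-Wolfe gap `max_{y ∈ X} ⟨Exp_x⁻¹(y), -grad f(x)⟩`. -/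
def fwGap (X : Set M) (f : M → ℝ) (x : M) : ℝ :=
  sSup ((fun y : M => inner ℝ (expInv E x y) (-riemGrad E f x)) '' X)

/-- `lin` is a Riemannian linear optimization oracle for `X`: on input `x ∈ X` and `g ∈ T_x M` it
returns a minimizer of `z ↦ ⟨g, Exp_x⁻¹(z)⟩` over `X`. -/
def IsLinearOracle (X : Set M) (lin : (x : M) → TangentSpace 𝓘(ℝ, E) x → M) : Prop :=
  ∀ x ∈ X, ∀ g : TangentSpace 𝓘(ℝ, E) x,
    lin x g ∈ X ∧ ∀ z ∈ X, inner ℝ g (expInv E x (lin x g)) ≤ inner ℝ g (expInv E x z)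

end Geometry

/-- The objective `Φ = (1/m) ∑ φ_i`. -/
def finiteSum {M : Type*} {m : ℕ} (φ : Fin m → M → ℝ) (x : M) : ℝ := (∑ i, φ i x) / m

/-! ### Randomized programs with oracle access, and their oracle costs -/

/-- Randomized programs that access the components `φ_i` only through an incremental first-order
oracle and the constraint set only through a linear optimization oracle. -/
inductive OracleProgram (E : Type*) [NormedAddCommGroup E] [NormedSpace ℝ E]
    (M : Type*) [TopologicalSpace M] [ChartedSpace E M] (m : ℕ) (α : Type*)
  /-- stop and return a value -/
  | done (a : α)
  /-- query the incremental first-order oracle at `(i, x)`; it answers `(φ_i x, grad φ_i x)` -/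
  | ifo (i : Fin m) (x : M) (next : ℝ × TangentSpace 𝓘(ℝ, E) x → OracleProgram E M m α)
  /-- query the linear optimization oracle at `(x, g)` -/
  | rlo (x : M) (g : TangentSpace 𝓘(ℝ, E) x) (next : M → OracleProgram E M m α)
  /-- draw an index uniformly at random from `n` indices, independently of all earlier draws -/
  | sample (n : ℕ) (hn : 0 < n) (next : Fin n → OracleProgram E M m α)

/-- The result of one run: the returned value and the numbers of oracle calls. -/
structure Outcome (α : Type*) where
  value : α
  ifoCalls : ℕ
  rloCalls : ℕ

namespace OracleProgram

variable {E : Type*} [NormedAddCommGroup E] [NormedSpace ℝ E]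

section Basic

variable {M : Type*} [TopologicalSpace M] [ChartedSpace E M] {m : ℕ}

/-- Sequential composition. -/
def bind {α β : Type*} : OracleProgram E M m α → (α → OracleProgram E M m β) →
    OracleProgram E M m β
  | done a, f => f a
  | ifo i x next, f => ifo i x fun r => (next r).bind f
  | rlo x g next, f => rlo x g fun z => (next z).bind f
  | sample n hn next, f => sample n hn fun i => (next i).bind f

/-- Run `n` programs one after the other and collect the results. -/
def collect {β : Type*} : (n : ℕ) → (Fin n → OracleProgram E M m β) →
    OracleProgram E M m (Fin n → β)
  | 0, _ => done Fin.elim0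
  | n + 1, f => (f 0).bind fun a => (collect n fun i => f i.succ).bind fun r =>
      done (Fin.cons a r)

end Basic

variable [FiniteDimensional ℝ E]
  {M : Type*} [MetricSpace M] [ChartedSpace E M] [IsManifold 𝓘(ℝ, E) ∞ M]
  [RiemannianBundle (fun x : M => TangentSpace 𝓘(ℝ, E) x)] {m : ℕ}

/-- The joint law of the returned value and of the numbers of oracle calls, when the oracles answer
according to `φ` and `lin`. -/
def run {α : Type*} (φ : Fin m → M → ℝ) (lin : (x : M) → TangentSpace 𝓘(ℝ, E) x → M) :
    OracleProgram E M m α → PMF (Outcome α)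
  | done a => PMF.pure ⟨a, 0, 0⟩
  | ifo i x next => (run φ lin (next (φ i x, riemGrad E (φ i) x))).map
      fun r => ⟨r.value, r.ifoCalls + 1, r.rloCalls⟩
  | rlo x g next => (run φ lin (next (lin x g))).map
      fun r => ⟨r.value, r.ifoCalls, r.rloCalls + 1⟩
  | sample n hn next =>
      haveI : Nonempty (Fin n) := ⟨⟨0, hn⟩⟩
      (PMF.uniformOfFintype (Fin n)).bind fun i => run φ lin (next i)

end OracleProgram

/-! ### The algorithm -/

section Algorithm

open OracleProgram

variable {E : Type*} [NormedAddCommGroup E] [NormedSpace ℝ E] [FiniteDimensional ℝ E]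
  {M : Type*} [MetricSpace M] [ChartedSpace E M] [IsManifold 𝓘(ℝ, E) ∞ M]
  [RiemannianBundle (fun x : M => TangentSpace 𝓘(ℝ, E) x)] {m : ℕ}

/-- The average of finitely many tangent vectors. -/
def meanVector {x : M} {n : ℕ} (v : Fin n → TangentSpace 𝓘(ℝ, E) x) : TangentSpace 𝓘(ℝ, E) x :=
  (n : ℝ)⁻¹ • ∑ j, v j

variable (E) in
/-- The gradients of all `m` components at the reference point `x₀` of an epoch (`m` oracle calls);
their average is the full gradient there. -/
def componentGradients (m : ℕ) (x₀ : M) :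
    OracleProgram E M m (Fin m → TangentSpace 𝓘(ℝ, E) x₀) :=
  collect m fun i => ifo i x₀ fun r => done r.2

/-- The variance-reduced gradient estimate at `x` from an i.i.d. uniform minibatch of size `b`,
`(1/b) ∑_j (grad φ_j(x) - Γ_{x₀}^{x} (grad φ_j(x₀) - grad Φ(x₀)))`, where `x₀` is the reference
point and `G` the list of component gradients at `x₀`. -/
def gradientEstimate (hm : 0 < m) (x₀ : M) (G : Fin m → TangentSpace 𝓘(ℝ, E) x₀) (b : ℕ) (x : M) :
    OracleProgram E M m (TangentSpace 𝓘(ℝ, E) x) :=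
  (collect b fun _ => sample m hm fun j => ifo j x fun r =>
    done (r.2 - parallelTransport x₀ x (G j - meanVector G))).bind fun v => done (meanVector v)

/-- One Frank-Wolfe step of size `η` from `x`. -/
def frankWolfeStep (hm : 0 < m) (x₀ : M) (G : Fin m → TangentSpace 𝓘(ℝ, E) x₀) (b : ℕ) (η : ℝ)
    (x : M) : OracleProgram E M m M :=
  (gradientEstimate hm x₀ G b x).bind fun g => rlo x g fun z => done (geodesicMap E x z η)

/-- `k` steps from `x`; returns the iterates at which steps were taken, and the final point. -/
def epochSteps (hm : 0 < m) (x₀ : M) (G : Fin m → TangentSpace 𝓘(ℝ, E) x₀) (b : ℕ) (η : ℝ) :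
    (k : ℕ) → M → OracleProgram E M m (List M × M)
  | 0, x => done ([], x)
  | k + 1, x => (frankWolfeStep hm x₀ G b η x).bind fun x' =>
      (epochSteps hm x₀ G b η k x').bind fun r => done (x :: r.1, r.2)

variable (E) in
/-- `s` epochs of `K` steps each, from the reference point `x₀`; the last point of an epoch is the
reference point of the next. Returns all iterates at which steps were taken. -/
def epochs (hm : 0 < m) (K b : ℕ) (η : ℝ) : (s : ℕ) → M → OracleProgram E M m (List M)
  | 0, _ => done []
  | s + 1, x₀ => (componentGradients E m x₀).bind fun G =>
      (epochSteps hm x₀ G b η K x₀).bind fun r =>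
        (epochs hm K b η s r.2).bind fun l => done (r.1 ++ l)

variable (E) in
/-- SVR-RFW with `S` epochs of length `K`, constant minibatch size `b` and constant step size `η`,
started at `x₀`. The output is chosen uniformly at random from the `K * S` iterates. -/
def svrRfw (hm : 0 < m) (S K b : ℕ) (η : ℝ) (x₀ : M) : OracleProgram E M m M :=
  (epochs E hm K b η S x₀).bind fun l =>
    if h : 0 < l.length then sample l.length h fun i => done (l.get i) else done x₀

variable (E) in
/-- The random output `x̂` is `ε`-accurate: the expectation of the Frank-Wolfe gap of `f` at `x̂`
is at most `ε`. -/
def IsEpsAccurate (X : Set M) (f : M → ℝ) (ε : ℝ) (p : PMF (Outcome M)) : Prop :=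
  ∃ g : ℝ, HasSum (fun r : Outcome M => (p r).toReal * fwGap E X f r.value) g ∧ g ≤ ε

end Algorithm

end

/-! The argument is a telescoping Frank-Wolfe estimate in which the gradient error costs no more
than the curvature error.

Geometry. For the Levi-Civita connection, inner products of parallel fields are constant. Hence
parallel transport is a linear isometry, and geodesics have constant speed. Since the velocity of a
geodesic is itself parallel, `L`-smoothness yields the Euclidean descent inequality along minimizing
geodesics (`IsLSmoothOn.descent`). Together with the optimality of the linear oracle this gives, for
any estimate `g` of the gradient at `x` and the resulting next point `x'`, η G(x) + Φ(x') ≤ Φ(x) +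
2Dη ‖grad Φ(x) - g‖ + (L/2) D² η² (`frankWolfe_progress`).

Variance. A single draw deviates from grad Φ(x) by a centred vector whose second moment is at most
(L d(x₀,x))², so a minibatch of size `b` has mean square error at most (L d(x₀,x))²/b. Each step
moves by at most ηD, so within an epoch d(x₀,x) ≤ KηD, and b = K² makes the root mean square error
at most LηD. A step therefore loses at most (5/2) L D² η² in expectation
(`expect_frankWolfeStep_le`).

Summation. Over all KS steps the values of Φ telescope, and the mean gap is at most Δ/(ηKS) + (5/2)
L D² η. For η = 1/√(KS) this is at most A/√(KS), where A depends only on L, D, Δ; so S is chosen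
with √(KS) ≥ A/ε.

Cost. Every run makes exactly S(m + K³) first-order calls and SK linear-oracle calls. The choice K ≈
m^(1/3) balances m against K³. -/

set_option linter.unusedSectionVars false

/-! ### The metric in a chart; inner products of parallel fields -/

noncomputable section RiemannianLemmas

variable {E : Type*} [NormedAddCommGroup E] [NormedSpace ℝ E] [FiniteDimensional ℝ E]
  {M : Type*} [MetricSpace M] [ChartedSpace E M] [IsManifold 𝓘(ℝ, E) ∞ M]
  [RiemannianBundle (fun x : M => TangentSpace 𝓘(ℝ, E) x)]

theorem metricAt_comm (p : M) (u v : TangentSpace 𝓘(ℝ, E) p) :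
    metricAt p u v = metricAt p v u := real_inner_comm _ _

theorem metricInChart_comm (p : M) (y u v : E) :
    metricInChart p y u v = metricInChart p y v u := metricAt_comm _ _ _

theorem metricDeriv_comm (p : M) (a u v : E) :
    metricDeriv p a u v = metricDeriv p a v u := by
  unfold metricDeriv
  simp_rw [metricInChart_comm p _ u v]

theorem metricInChart_self (p : M) (u v : E) :
    metricInChart p (extChartAt 𝓘(ℝ, E) p p) u v = metricAt (E := E) p u v := by
  have h : ∀ q : M, q = p → metricAt (E := E) q (tangentCoordChange 𝓘(ℝ, E) p q q u)
      (tangentCoordChange 𝓘(ℝ, E) p q q v) = metricAt (E := E) p u v := by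
    rintro q rfl
    rw [tangentCoordChange_self (mem_extChartAt_source _),
      tangentCoordChange_self (mem_extChartAt_source _)]
  exact h _ (extChartAt_to_inv p)

/-- The metric in a chart as a bilinear form. -/
def metricForm (p : M) (y : E) : E →ₗ[ℝ] E →ₗ[ℝ] ℝ :=
  LinearMap.mk₂ ℝ (metricInChart p y)
    (fun u u' v => by simp only [metricInChart, metricAt, map_add]; exact inner_add_left _ _ _)
    (fun c u v => by
      simp only [metricInChart, metricAt, map_smul]; exact real_inner_smul_left _ _ _)
    (fun u v v' => by simp only [metricInChart, metricAt, map_add]; exact inner_add_right _ _ _)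
    (fun c u v => by
      simp only [metricInChart, metricAt, map_smul]; exact real_inner_smul_right _ _ _)

/-- Reduces differentiation of the metric with moving arguments to finitely many scalar coefficient
functions. -/
theorem metricInChart_eq_sum {ι : Type*} [Fintype ι] (b : Module.Basis ι ℝ E) (p : M) (y u v : E) :
    metricInChart p y u v =
      ∑ i, ∑ j, b.repr u i * b.repr v j * metricInChart p y (b i) (b j) := by
  change metricForm p y u v = ∑ i, ∑ j, b.repr u i * b.repr v j * metricForm p y (b i) (b j)
  conv_lhs => rw [← b.sum_repr u, ← b.sum_repr v]
  simp only [map_sum, map_smul, LinearMap.sum_apply, LinearMap.smul_apply, smul_eq_mul,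
    Finset.mul_sum, mul_assoc]
  rw [Finset.sum_comm]
  exact Finset.sum_congr rfl fun i _ => Finset.sum_congr rfl fun j _ => by ring

section Smooth

variable [IsContMDiffRiemannianBundle 𝓘(ℝ, E) ∞ E (fun x : M => TangentSpace 𝓘(ℝ, E) x)]

/-- On the source of the chart at `p` the two coordinate changes cancel, so this local field is
constant in the trivialization at `p`. It serves to derive smoothness of the metric coefficients
from smoothness of the bundle metric. -/
theorem contMDiffAt_constantInChart (p : M) (u : E) :
    ContMDiffAt 𝓘(ℝ, E) (𝓘(ℝ, E).prod 𝓘(ℝ, E)) ∞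
      (fun q => (⟨q, tangentCoordChange 𝓘(ℝ, E) p q q u⟩ : TangentBundle 𝓘(ℝ, E) M)) p := by
  rw [Bundle.contMDiffAt_totalSpace]
  refine ⟨contMDiffAt_id, ?_⟩
  refine (contMDiffAt_const (c := u)).congr_of_eventuallyEq ?_
  filter_upwards [extChartAt_source_mem_nhds (I := 𝓘(ℝ, E)) p] with q hq
  change tangentCoordChange 𝓘(ℝ, E) q p q (tangentCoordChange 𝓘(ℝ, E) p q q u) = u
  rw [tangentCoordChange_comp ⟨⟨hq, mem_extChartAt_source _⟩, hq⟩, tangentCoordChange_self hq]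

theorem differentiableAt_metricInChart (p : M) (u v : E) :
    DifferentiableAt ℝ (fun y => metricInChart p y u v) (extChartAt 𝓘(ℝ, E) p p) := by
  have h := ContMDiffAt.inner_bundle (F := E) (E := fun x : M => TangentSpace 𝓘(ℝ, E) x)
    (b := fun q : M => q) (v := fun q => tangentCoordChange 𝓘(ℝ, E) p q q u)
    (w := fun q => tangentCoordChange 𝓘(ℝ, E) p q q v)
    (contMDiffAt_constantInChart (E := E) p u) (contMDiffAt_constantInChart (E := E) p v)
  have h2 : ContMDiffAt 𝓘(ℝ, E) 𝓘(ℝ, E) ∞ (extChartAt 𝓘(ℝ, E) p).symm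
      (extChartAt 𝓘(ℝ, E) p p) :=
    (contMDiffOn_extChartAt_symm p).contMDiffAt (extChartAt_target_mem_nhds p)
  have h3 := ContMDiffAt.comp_of_eq h h2 (extChartAt_to_inv p)
  exact h3.contDiffAt.differentiableAt (by simp)

theorem metricDeriv_eq_sum {ι : Type*} [Fintype ι] (b : Module.Basis ι ℝ E) (p : M) (a u v : E) :
    metricDeriv p a u v =
      ∑ i, ∑ j, b.repr u i * b.repr v j * metricDeriv p a (b i) (b j) := by
  have h : HasFDerivAt (fun y => metricInChart p y u v)
      (∑ i, ∑ j, (b.repr u i * b.repr v j) •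
        fderiv ℝ (fun y => metricInChart p y (b i) (b j)) (extChartAt 𝓘(ℝ, E) p p))
      (extChartAt 𝓘(ℝ, E) p p) := by
    simp_rw [metricInChart_eq_sum b p _ u v]
    exact HasFDerivAt.fun_sum fun i _ => HasFDerivAt.fun_sum fun j _ =>
      (differentiableAt_metricInChart p (b i) (b j)).hasFDerivAt.const_mul _
  rw [metricDeriv, h.fderiv]
  simp [metricDeriv, -extChartAt]

/-- Product rule for g(u, v) along a curve. The curve has to pass through the centre of the chart at
time `t`, because `metricDeriv` differentiates the coefficients only there. -/
theorem hasDerivWithinAt_metricInChart (p : M) {c u v : ℝ → E} {c' u' v' : E} {s : Set ℝ} {t : ℝ}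
    (hc : HasDerivWithinAt c c' s t) (hu : HasDerivWithinAt u u' s t)
    (hv : HasDerivWithinAt v v' s t) (hct : c t = extChartAt 𝓘(ℝ, E) p p) :
    HasDerivWithinAt (fun r => metricInChart p (c r) (u r) (v r))
      (metricAt (E := E) p u' (v t) + metricAt (E := E) p (u t) v' + metricDeriv p c' (u t) (v t))
      s t := by
  let b := Module.finBasis ℝ E
  have hcoord : ∀ {w : ℝ → E} {w' : E}, HasDerivWithinAt w w' s t → ∀ i,
      HasDerivWithinAt (fun r => b.repr (w r) i) (b.repr w' i) s t := fun hw i =>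
    ((b.coord i).toContinuousLinearMap.hasFDerivAt.comp_hasDerivWithinAt t hw)
  have hg : ∀ i j, HasDerivWithinAt (fun r => metricInChart p (c r) (b i) (b j))
      (metricDeriv p c' (b i) (b j)) s t := fun i j => by
    have h := (differentiableAt_metricInChart p (b i) (b j)).hasFDerivAt
    rw [← hct] at h
    have h2 := h.comp_hasDerivWithinAt t hc
    rw [hct] at h2
    exact h2
  rw [← metricInChart_self, ← metricInChart_self, metricDeriv_eq_sum b,
    metricInChart_eq_sum b p _ u', metricInChart_eq_sum b p _ _ v']
  simp_rw [metricInChart_eq_sum b p (c _) (u _) (v _)]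
  have h := HasDerivWithinAt.fun_sum (u := Finset.univ) fun i _ =>
    HasDerivWithinAt.fun_sum (u := Finset.univ) fun j _ =>
    ((hcoord hu i).mul (hcoord hv j)).mul (hg i j)
  refine h.congr_deriv ?_
  simp only [← Finset.sum_add_distrib, hct]
  refine Finset.sum_congr rfl fun i _ => Finset.sum_congr rfl fun j _ => by
    simp only [Pi.mul_apply]; ring

theorem metricAt_eq_metricInChart {γ : ℝ → M} (V W : (t : ℝ) → TangentSpace 𝓘(ℝ, E) (γ t))
    {p : M} {s : ℝ} (hs : γ s ∈ (extChartAt 𝓘(ℝ, E) p).source) :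
    metricAt (γ s) (V s) (W s) = metricInChart p (extChartAt 𝓘(ℝ, E) p (γ s))
      (coordAlong γ V p s) (coordAlong γ W p s) := by
  have h : ∀ q : M, q = γ s → metricAt (E := E) q
      (tangentCoordChange 𝓘(ℝ, E) p q q (coordAlong γ V p s))
      (tangentCoordChange 𝓘(ℝ, E) p q q (coordAlong γ W p s)) = metricAt (γ s) (V s) (W s) := by
    rintro q rfl
    unfold coordAlong
    have hm := mem_extChartAt_source (I := 𝓘(ℝ, E)) (γ s)
    have e : ∀ v : E, tangentCoordChange 𝓘(ℝ, E) p (γ s) (γ s)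
        (tangentCoordChange 𝓘(ℝ, E) (γ s) p (γ s) v) = v := fun v => by
      rw [tangentCoordChange_comp ⟨⟨hm, hs⟩, hm⟩, tangentCoordChange_self hm]
    exact congrArg₂ (metricAt (E := E) (γ s)) (e (V s)) (e (W s))
  exact (h _ ((extChartAt 𝓘(ℝ, E) p).left_inv hs)).symm

theorem hasDerivWithinAt_extChartAt_velocity {γ : ℝ → M} {t : ℝ}
    (h : MDifferentiableWithinAt 𝓘(ℝ, ℝ) 𝓘(ℝ, E) γ (Icc 0 1) t) :
    HasDerivWithinAt (fun s => extChartAt 𝓘(ℝ, E) (γ t) (γ s)) (velocity E γ t) (Icc 0 1) t := by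
  have h3 := h.hasMFDerivWithinAt.2
  simp only [writtenInExtChartAt, mfld_simps] at h3
  have key : ∀ {f : ℝ → E} {L : ℝ →L[ℝ] E} {S : Set ℝ}, HasFDerivWithinAt f L S t →
      HasDerivWithinAt f (L 1) S t := fun h => h.hasDerivWithinAt
  exact key h3

/-- The inner product of two parallel vector fields is constant. -/
theorem hasDerivWithinAt_metricAt_of_parallel {γ : ℝ → M}
    {V W : (t : ℝ) → TangentSpace 𝓘(ℝ, E) (γ t)}
    (hγ : MDifferentiableOn 𝓘(ℝ, ℝ) 𝓘(ℝ, E) γ (Icc 0 1))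
    (hV : IsParallelAlong γ V) (hW : IsParallelAlong γ W) {t : ℝ} (ht : t ∈ Icc (0 : ℝ) 1) :
    HasDerivWithinAt (fun s => metricAt (γ s) (V s) (W s)) 0 (Icc 0 1) t := by
  obtain ⟨hV1, hV2⟩ := hV t ht
  obtain ⟨hW1, hW2⟩ := hW t ht
  have hself : ∀ U : (t : ℝ) → TangentSpace 𝓘(ℝ, E) (γ t), coordAlong γ U (γ t) t = U t :=
    fun U => tangentCoordChange_self (mem_extChartAt_source _)
  have h := hasDerivWithinAt_metricInChart (γ t) (hasDerivWithinAt_extChartAt_velocity (hγ t ht))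
    hV1.hasDerivWithinAt hW1.hasDerivWithinAt rfl
  rw [hself, hself] at h
  refine (h.congr_of_eventuallyEq ?_ ?_).congr_deriv ?_
  · filter_upwards [(hγ t ht).continuousWithinAt
      (extChartAt_source_mem_nhds (I := 𝓘(ℝ, E)) (γ t))] with s hs
    exact metricAt_eq_metricInChart V W hs
  · exact metricAt_eq_metricInChart V W (mem_extChartAt_source _)
  -- The parallel equations turn the terms in V' and W' into -Γ(γ', V, W) - Γ(γ', W, V). By symmetry
  -- of g the remaining parts of the two Christoffel symbols cancel, and their sum is the derivative
  -- of g(V, W) in the direction γ'.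
  · have a := hV2 (W t)
    have b := hW2 (V t)
    simp only at a b
    generalize derivWithin (coordAlong γ V (γ t)) (Icc 0 1) t = V' at a ⊢
    generalize derivWithin (coordAlong γ W (γ t)) (Icc 0 1) t = W' at b ⊢
    have e : metricAt (γ t) (V t) W' = metricAt (γ t) W' (V t) := metricAt_comm (γ t) (V t) W'
    rw [e]
    unfold christoffel at a b
    rw [metricDeriv_comm (E := E) (γ t) (velocity E γ t) (W t) (V t)] at b
    rw [metricDeriv_comm (E := E) (γ t) (V t) (velocity E γ t) (W t)] at a
    rw [metricDeriv_comm (E := E) (γ t) (V t) (velocity E γ t) (W t)] at b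
    linarith

theorem metricAt_eq_of_parallel {γ : ℝ → M}
    {V W : (t : ℝ) → TangentSpace 𝓘(ℝ, E) (γ t)}
    (hγ : MDifferentiableOn 𝓘(ℝ, ℝ) 𝓘(ℝ, E) γ (Icc 0 1))
    (hV : IsParallelAlong γ V) (hW : IsParallelAlong γ W) {t : ℝ} (ht : t ∈ Icc (0 : ℝ) 1) :
    metricAt (γ t) (V t) (W t) = metricAt (γ 0) (V 0) (W 0) := by
  have h := fun s hs => hasDerivWithinAt_metricAt_of_parallel hγ hV hW (t := s) hs
  refine constant_of_derivWithin_zero (fun s hs => (h s hs).differentiableWithinAt)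
    (fun s hs => ?_) t ht
  exact (h s ⟨hs.1, hs.2.le⟩).derivWithin (uniqueDiffOn_Icc zero_lt_one s ⟨hs.1, hs.2.le⟩)

end Smooth

end RiemannianLemmas

/-! ### Linearity and uniqueness of parallel transport; speed and rescaling of geodesics -/

noncomputable section GeodesicLemmas

variable {E : Type*} [NormedAddCommGroup E] [NormedSpace ℝ E] [FiniteDimensional ℝ E]
  {M : Type*} [MetricSpace M] [ChartedSpace E M] [IsManifold 𝓘(ℝ, E) ∞ M]
  [RiemannianBundle (fun x : M => TangentSpace 𝓘(ℝ, E) x)]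
  [IsContMDiffRiemannianBundle 𝓘(ℝ, E) ∞ E (fun x : M => TangentSpace 𝓘(ℝ, E) x)]

theorem metricAt_smul_add_left (p : M) (c : ℝ) (u u' v : E) :
    metricAt (E := E) p (c • u + u' : E) v =
      c * metricAt (E := E) p u v + metricAt (E := E) p u' v :=
  (inner_add_left (𝕜 := ℝ) (E := TangentSpace 𝓘(ℝ, E) p) _ _ _).trans
    (congrArg (· + _) (real_inner_smul_left (F := TangentSpace 𝓘(ℝ, E) p) _ _ _))

theorem metricAt_self_eq_zero {p : M} {u : E} : metricAt (E := E) p u u = 0 ↔ u = 0 :=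
  inner_self_eq_zero (𝕜 := ℝ) (E := TangentSpace 𝓘(ℝ, E) p)

theorem metricDeriv_smul_add_middle (p : M) (c : ℝ) (a u u' v : E) :
    metricDeriv p a (c • u + u') v = c * metricDeriv p a u v + metricDeriv p a u' v := by
  let b := Module.finBasis ℝ E
  simp only [metricDeriv_eq_sum b p a _ v, Finset.mul_sum, ← Finset.sum_add_distrib]
  refine Finset.sum_congr rfl fun i _ => Finset.sum_congr rfl fun j _ => ?_
  simp only [map_add, map_smul, Finsupp.add_apply, Finsupp.smul_apply, smul_eq_mul]
  ring

theorem metricDeriv_smul_add_right (p : M) (c : ℝ) (a u v v' : E) :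
    metricDeriv p a u (c • v + v') = c * metricDeriv p a u v + metricDeriv p a u v' := by
  rw [metricDeriv_comm, metricDeriv_smul_add_middle, metricDeriv_comm p a v,
    metricDeriv_comm p a v']

theorem metricDeriv_smul_add_left (p : M) (c : ℝ) (a a' u v : E) :
    metricDeriv p (c • a + a') u v = c * metricDeriv p a u v + metricDeriv p a' u v := by
  simp only [metricDeriv, map_add, map_smul, smul_eq_mul]

theorem christoffel_smul_add_middle (p : M) (c : ℝ) (u v v' w : E) :
    christoffel p u (c • v + v') w = c * christoffel p u v w + christoffel p u v' w := by
  simp only [christoffel, metricDeriv_smul_add_middle, metricDeriv_smul_add_left,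
    metricDeriv_smul_add_right]
  ring

theorem christoffel_comm (p : M) (u v w : E) : christoffel p u v w = christoffel p v u w := by
  simp only [christoffel, metricDeriv_comm p w u v]
  ring

theorem christoffel_smul_smul (p : M) (c : ℝ) (u v w : E) :
    christoffel p (c • u) (c • v) w = c * (c * christoffel p u v w) := by
  have h : ∀ u v : E, christoffel p u (c • v) w = c * christoffel p u v w := fun u v => by
    have h0 := christoffel_smul_add_middle p 1 u 0 0 w
    have h1 := christoffel_smul_add_middle p c u v 0 w
    simp only [smul_zero, add_zero] at h0 h1
    linarith
  rw [h, christoffel_comm, h, christoffel_comm]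

/-- For a fixed curve the parallel equation is linear in the field; the shape `c • V + W` covers
sums, multiples and differences at once. -/
theorem IsParallelAlong.smul_add {γ : ℝ → M} {V W : (t : ℝ) → TangentSpace 𝓘(ℝ, E) (γ t)}
    (hV : IsParallelAlong γ V) (hW : IsParallelAlong γ W) (c : ℝ) :
    IsParallelAlong γ (fun t => (c • V t + W t : TangentSpace 𝓘(ℝ, E) (γ t))) := by
  intro t ht
  obtain ⟨hV1, hV2⟩ := hV t ht
  obtain ⟨hW1, hW2⟩ := hW t ht
  have hcoord : coordAlong (E := E) γ (fun t => c • V t + W t) (γ t) =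
      fun s => c • coordAlong γ V (γ t) s + coordAlong γ W (γ t) s := by
    funext s
    have e : ∀ (T : E →L[ℝ] E) (v w : E), T (c • v + w) = c • T v + T w := by simp
    exact e _ _ _
  have hd := (hV1.hasDerivWithinAt.const_smul c).add hW1.hasDerivWithinAt
  rw [hcoord]
  refine ⟨hd.differentiableWithinAt, fun w => ?_⟩
  have hd' := hd.derivWithin (uniqueDiffOn_Icc zero_lt_one t ht)
  have a := hV2 w
  have b := hW2 w
  simp only at a b ⊢
  erw [hd', metricAt_smul_add_left, christoffel_smul_add_middle]
  linear_combination c * a + b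

theorem isParallelAlong_zero (γ : ℝ → M) :
    IsParallelAlong γ (fun t => (0 : TangentSpace 𝓘(ℝ, E) (γ t))) := by
  intro t ht
  have hcoord : coordAlong (E := E) γ (fun t => (0 : TangentSpace 𝓘(ℝ, E) (γ t))) (γ t) =
      fun s => 0 := by
    funext s
    exact map_zero (tangentCoordChange 𝓘(ℝ, E) (γ s) (γ t) (γ s))
  rw [hcoord]
  refine ⟨differentiableWithinAt_const _, fun w => ?_⟩
  have h1 := metricAt_smul_add_left (E := E) (γ t) 1 0 0 w
  have h2 := christoffel_smul_add_middle (E := E) (γ t) 1 (velocity E γ t) 0 0 w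
  simp only [smul_zero, add_zero] at h1 h2
  simp only [derivWithin_fun_const, Pi.zero_apply]
  exact (by linarith : metricAt (E := E) (γ t) (0 : E) w +
    christoffel (E := E) (γ t) (velocity E γ t) (0 : E) w = 0)

/-- All tangent spaces are `E` by definition, so keeping the vectors in `E` lets end-point
identities such as γ 1 = y be used without casts. -/
theorem metricAt_congr {p q : M} (h : p = q) (u v : E) :
    metricAt (E := E) p u v = metricAt (E := E) q u v := by rw [h]

/-! ### Parallel transport -/

theorem isMinimizingGeodesic_geodesicMap {x y : M}
    (h : ∃ γ, IsMinimizingGeodesic E x y γ) :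
    IsMinimizingGeodesic E x y (geodesicMap E x y) := by
  rw [geodesicMap, dif_pos h]
  exact h.choose_spec

theorem IsGeodesic.mdifferentiableOn {γ : ℝ → M} (h : IsGeodesic E γ) :
    MDifferentiableOn 𝓘(ℝ, ℝ) 𝓘(ℝ, E) γ (Icc 0 1) := h.1.mdifferentiableOn (by simp)

section Transport

variable {x y : M} (hxy : ∃ γ, IsMinimizingGeodesic E x y γ)
include hxy

theorem IsParallelTransport.metricAt_eq {v v' : TangentSpace 𝓘(ℝ, E) x}
    {w w' : TangentSpace 𝓘(ℝ, E) y}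
    (h : IsParallelTransport x y v w) (h' : IsParallelTransport x y v' w') :
    metricAt y w w' = metricAt x v v' := by
  have hg := isMinimizingGeodesic_geodesicMap hxy
  obtain ⟨V, hV, rfl, rfl⟩ := h
  obtain ⟨V', hV', rfl, rfl⟩ := h'
  have := metricAt_eq_of_parallel hg.1.mdifferentiableOn hV hV'
    (right_mem_Icc.2 zero_le_one)
  exact (metricAt_congr (E := E) hg.2.2.1 _ _).symm.trans
    (this.trans (metricAt_congr (E := E) hg.2.1 _ _))

omit hxy in
theorem IsParallelTransport.smul_add {v v' : TangentSpace 𝓘(ℝ, E) x}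
    {w w' : TangentSpace 𝓘(ℝ, E) y} (h : IsParallelTransport x y v w)
    (h' : IsParallelTransport x y v' w') (c : ℝ) :
    IsParallelTransport x y (c • v + v') (c • w + w') := by
  obtain ⟨V, hV, rfl, rfl⟩ := h
  obtain ⟨V', hV', rfl, rfl⟩ := h'
  exact ⟨_, hV.smul_add hV' c, rfl, rfl⟩

omit hxy in
theorem isParallelTransport_zero :
    IsParallelTransport x y (0 : TangentSpace 𝓘(ℝ, E) x) (0 : TangentSpace 𝓘(ℝ, E) y) :=
  ⟨_, isParallelAlong_zero _, rfl, rfl⟩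

omit hxy in
theorem isParallelTransport_sum {ι : Type*} (s : Finset ι) {v : ι → TangentSpace 𝓘(ℝ, E) x}
    {w : ι → TangentSpace 𝓘(ℝ, E) y} (h : ∀ i ∈ s, IsParallelTransport x y (v i) (w i)) :
    IsParallelTransport x y (∑ i ∈ s, v i) (∑ i ∈ s, w i) := by
  classical
  induction s using Finset.induction_on with
  | empty => exact isParallelTransport_zero
  | insert i s hi ih =>
    have := (h i (Finset.mem_insert_self i s)).smul_add
      (ih fun j hj => h j (Finset.mem_insert_of_mem hj)) 1
    simpa only [Finset.sum_insert hi, one_smul] using this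

/-- No uniqueness theorem for differential equations is needed: the difference of two transports of
`v` is a transport of 0, and transport preserves norms. -/
theorem IsParallelTransport.unique {v : TangentSpace 𝓘(ℝ, E) x}
    {w w' : TangentSpace 𝓘(ℝ, E) y}
    (h : IsParallelTransport x y v w) (h' : IsParallelTransport x y v w') : w = w' := by
  have h1 := h'.smul_add h (-1)
  have h2 := h1.metricAt_eq hxy h1
  have h3 : (-1 : ℝ) • v + v = 0 := by simp
  rw [h3] at h2
  have h4 := metricAt_self_eq_zero.1 (h2.trans (metricAt_self_eq_zero.2 rfl))
  have h5 : (-1 : ℝ) • w' + w = 0 := h4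
  rw [neg_one_smul, neg_add_eq_zero] at h5
  exact h5.symm

theorem IsParallelTransport.parallelTransport_eq {v : TangentSpace 𝓘(ℝ, E) x}
    {w : TangentSpace 𝓘(ℝ, E) y} (h : IsParallelTransport x y v w) :
    parallelTransport x y v = w := by
  have hex : ∃ w : TangentSpace 𝓘(ℝ, E) y, IsParallelTransport x y v w := ⟨w, h⟩
  rw [parallelTransport, dif_pos hex]
  exact hex.choose_spec.unique hxy h

end Transport

/-! ### Minimizing geodesics -/

theorem metricAt_self (p : M) (u : TangentSpace 𝓘(ℝ, E) p) : metricAt p u u = ‖u‖ ^ 2 :=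
  real_inner_self_eq_norm_sq u

theorem IsGeodesic.norm_velocity {γ : ℝ → M} (h : IsGeodesic E γ) {t : ℝ}
    (ht : t ∈ Icc (0 : ℝ) 1) : ‖velocity E γ t‖ = ‖velocity E γ 0‖ := by
  have := metricAt_eq_of_parallel h.mdifferentiableOn h.2 h.2 ht
  rw [metricAt_self, metricAt_self] at this
  exact (sq_eq_sq₀ (norm_nonneg _) (norm_nonneg _)).1 this

theorem IsGeodesic.pathELength_eq {γ : ℝ → M} (h : IsGeodesic E γ) {a b : ℝ} (ha : 0 ≤ a)
    (hab : a ≤ b) (hb : b ≤ 1) :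
    pathELength 𝓘(ℝ, E) γ a b = ENNReal.ofReal ((b - a) * ‖velocity E γ 0‖) := by
  -- On the open interval the derivative within [0, 1] that defines `velocity` is the ordinary
  -- derivative.
  rw [pathELength_eq_lintegral_mfderiv_Ioo]
  have : ∀ t ∈ Ioo a b, ‖mfderiv 𝓘(ℝ, ℝ) 𝓘(ℝ, E) γ t (1 : ℝ)‖ₑ =
      ENNReal.ofReal ‖velocity E γ 0‖ := fun t ht => by
    have ht' : t ∈ Icc (0 : ℝ) 1 := ⟨ha.trans ht.1.le, ht.2.le.trans hb⟩
    rw [← h.norm_velocity ht', ofReal_norm, velocity, mfderivWithin_of_mem_nhds]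
    exact Icc_mem_nhds (ha.trans_lt ht.1) (ht.2.trans_le hb)
  refine (MeasureTheory.setLIntegral_congr_fun measurableSet_Ioo this).trans ?_
  rw [MeasureTheory.setLIntegral_const, Real.volume_Ioo, mul_comm,
    ENNReal.ofReal_mul (sub_nonneg.2 hab)]

theorem IsMinimizingGeodesic.norm_velocity {x y : M} {γ : ℝ → M}
    (h : IsMinimizingGeodesic E x y γ) {t : ℝ} (ht : t ∈ Icc (0 : ℝ) 1) :
    ‖velocity E γ t‖ = dist x y := by
  have h1 := h.2.2.2
  rw [h.1.pathELength_eq le_rfl zero_le_one le_rfl, edist_dist, sub_zero, one_mul,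
    ENNReal.ofReal_eq_ofReal_iff (norm_nonneg _) dist_nonneg] at h1
  rw [h.1.norm_velocity ht, h1]

section Distance

variable [IsRiemannianManifold 𝓘(ℝ, E) M]

theorem IsMinimizingGeodesic.dist_le {x y : M} {γ : ℝ → M}
    (h : IsMinimizingGeodesic E x y γ) {a b : ℝ} (ha : 0 ≤ a) (hab : a ≤ b) (hb : b ≤ 1) :
    dist (γ a) (γ b) ≤ (b - a) * dist x y := by
  have h1 : edist (γ a) (γ b) ≤ pathELength 𝓘(ℝ, E) γ a b := by
    rw [IsRiemannianManifold.out (I := 𝓘(ℝ, E)) (γ a) (γ b)]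
    exact riemannianEDist_le_pathELength
      ((h.1.1.mono (Icc_subset_Icc ha hb)).of_le (by simp)) rfl rfl hab
  rw [h.1.pathELength_eq ha hab hb, h.norm_velocity (left_mem_Icc.2 zero_le_one),
    edist_dist] at h1
  exact (ENNReal.ofReal_le_ofReal_iff
    (mul_nonneg (sub_nonneg.2 hab) dist_nonneg)).1 h1

/-- The two pieces have lengths at most t d(x,y) and (1-t) d(x,y); the triangle inequality forces
equality in both. -/
theorem IsMinimizingGeodesic.dist_eq {x y : M} {γ : ℝ → M}
    (h : IsMinimizingGeodesic E x y γ) {t : ℝ} (ht : t ∈ Icc (0 : ℝ) 1) :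
    dist x (γ t) = t * dist x y := by
  have h1 := h.dist_le le_rfl ht.1 ht.2
  have h2 := h.dist_le ht.1 ht.2 le_rfl
  rw [h.2.1] at h1
  rw [h.2.2.1] at h2
  have := dist_triangle x (γ t) y
  linarith

theorem mul_mem_Icc {t s : ℝ} (ht : t ∈ Icc (0 : ℝ) 1) (hs : s ∈ Icc (0 : ℝ) 1) :
    t * s ∈ Icc (0 : ℝ) 1 :=
  ⟨mul_nonneg ht.1 hs.1, mul_le_one₀ ht.2 hs.1 hs.2⟩

theorem velocity_comp_mul {γ : ℝ → M}
    (hγ : MDifferentiableOn 𝓘(ℝ, ℝ) 𝓘(ℝ, E) γ (Icc 0 1)) {t s : ℝ} (ht : t ∈ Icc (0 : ℝ) 1)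
    (hs : s ∈ Icc (0 : ℝ) 1) :
    (velocity E (fun r => γ (t * r)) s : E) = t • (velocity E γ (t * s) : E) := by
  have hf : HasDerivWithinAt (fun r : ℝ => t * r) t (Icc 0 1) s := by
    simpa using (hasDerivWithinAt_id s (Icc 0 1)).const_mul t
  have h1 := (hγ (t * s) (mul_mem_Icc ht hs)).hasMFDerivWithinAt
  have h2 := h1.comp s hf.hasFDerivWithinAt.hasMFDerivWithinAt
    (fun r hr => mul_mem_Icc ht hr)
  have h3 := h2.mfderivWithin
    ((uniqueDiffOn_Icc zero_lt_one s hs).uniqueMDiffWithinAt)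
  have key : ∀ (L : ℝ →L[ℝ] E), (L.comp (ContinuousLinearMap.toSpanSingleton ℝ t)) 1 = t • L 1 := by
    intro L
    rw [← map_smul]
    simp
  have h4 : (velocity E (γ ∘ fun r => t * r) s : E) = t • (velocity E γ (t * s) : E) := by
    rw [velocity, h3]
    exact key _
  exact h4

/-- Rescaling time by `t` multiplies the velocity by t. The acceleration and the quadratic
Christoffel term both acquire the factor t², so the geodesic equation persists, also for t = 0. -/
theorem IsGeodesic.comp_mul {γ : ℝ → M} (h : IsGeodesic E γ) {t : ℝ} (ht : t ∈ Icc (0 : ℝ) 1) :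
    IsGeodesic E (fun r => γ (t * r)) := by
  have hmaps : MapsTo (fun r : ℝ => t * r) (Icc 0 1) (Icc 0 1) := fun r hr => mul_mem_Icc ht hr
  refine ⟨h.1.comp (f := fun r : ℝ => t * r) (contMDiffOn_iff_contDiffOn.2
    (contDiff_const.mul contDiff_id).contDiffOn) hmaps, fun s hs => ?_⟩
  obtain ⟨h1, h2⟩ := h.2 (t * s) (mul_mem_Icc ht hs)
  have hcoord : EqOn (coordAlong (E := E) (fun r => γ (t * r))
      (velocity E (fun r => γ (t * r))) (γ (t * s)))
      (fun r => t • coordAlong γ (velocity E γ) (γ (t * s)) (t * r)) (Icc 0 1) := by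
    intro r hr
    have e : ∀ (T : E →L[ℝ] E) (v w : E), w = t • v → T w = t • T v := by
      rintro T v w rfl; simp
    exact e _ _ _ (velocity_comp_mul h.mdifferentiableOn ht hr)
  have hf : HasDerivWithinAt (fun r : ℝ => t * r) t (Icc 0 1) s := by
    simpa using (hasDerivWithinAt_id s (Icc 0 1)).const_mul t
  have hd := ((h1.hasDerivWithinAt.scomp s hf hmaps).const_smul t).congr hcoord (hcoord hs)
  refine ⟨hd.differentiableWithinAt, fun w => ?_⟩
  have hd' := hd.derivWithin (uniqueDiffOn_Icc zero_lt_one s hs)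
  have a := h2 w
  simp only at a ⊢
  have e1 : ∀ D : E, metricAt (E := E) (γ (t * s)) (t • t • D : E) w =
      t * (t * metricAt (E := E) (γ (t * s)) D w) := fun D => by
    have e : ∀ D : E, metricAt (E := E) (γ (t * s)) (t • D : E) w =
      t * metricAt (E := E) (γ (t * s)) D w := fun D =>
      real_inner_smul_left (F := TangentSpace 𝓘(ℝ, E) (γ (t * s))) _ _ _
    rw [e, e]
  erw [hd', velocity_comp_mul h.mdifferentiableOn ht hs, e1, christoffel_smul_smul]
  linear_combination t * t * a

theorem IsMinimizingGeodesic.comp_mul {x y : M} {γ : ℝ → M}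
    (h : IsMinimizingGeodesic E x y γ) {t : ℝ} (ht : t ∈ Icc (0 : ℝ) 1) :
    IsMinimizingGeodesic E x (γ t) (fun r => γ (t * r)) := by
  refine ⟨h.1.comp_mul ht, by simp [h.2.1], by simp, ?_⟩
  have h0 : (0 : ℝ) ∈ Icc (0 : ℝ) 1 := left_mem_Icc.2 zero_le_one
  have hv : ‖velocity E (fun r => γ (t * r)) 0‖ = t * dist x y := by
    have h1 := velocity_comp_mul h.1.mdifferentiableOn ht h0
    have h2 := h.norm_velocity (mul_mem_Icc ht h0)
    have key : ∀ (p : M) (u v : TangentSpace 𝓘(ℝ, E) p), (u : E) = t • (v : E) →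
        ‖u‖ = t * ‖v‖ := by
      rintro p u v huv
      have : u = t • v := huv
      rw [this, norm_smul, Real.norm_of_nonneg ht.1]
    rw [← h2]
    exact key _ _ _ h1
  rw [(h.1.comp_mul ht).pathELength_eq le_rfl zero_le_one le_rfl, hv, sub_zero, one_mul,
    edist_dist, h.dist_eq ht]

end Distance

end GeodesicLemmas

/-! ### Gradients, the descent inequality and the progress of a Frank-Wolfe step -/

noncomputable section FrankWolfeLemmas

variable {E : Type*} [NormedAddCommGroup E] [NormedSpace ℝ E] [FiniteDimensional ℝ E]
  {M : Type*} [MetricSpace M] [ChartedSpace E M] [IsManifold 𝓘(ℝ, E) ∞ M]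
  [RiemannianBundle (fun x : M => TangentSpace 𝓘(ℝ, E) x)]
  [IsContMDiffRiemannianBundle 𝓘(ℝ, E) ∞ E (fun x : M => TangentSpace 𝓘(ℝ, E) x)]

theorem inner_riemGrad (f : M → ℝ) (x : M) (v : TangentSpace 𝓘(ℝ, E) x) :
    inner ℝ (riemGrad E f x) v = (mfderiv 𝓘(ℝ, E) 𝓘(ℝ, ℝ) f x v : ℝ) := by
  have : FiniteDimensional ℝ (TangentSpace 𝓘(ℝ, E) x) := inferInstanceAs (FiniteDimensional ℝ E)
  have : CompleteSpace (TangentSpace 𝓘(ℝ, E) x) := FiniteDimensional.complete ℝ _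
  exact InnerProductSpace.toDual_symm_apply

theorem riemGrad_eq_of_hasMFDerivAt {f : M → ℝ} {x : M} {f' : TangentSpace 𝓘(ℝ, E) x →L[ℝ] ℝ}
    (h : HasMFDerivAt 𝓘(ℝ, E) 𝓘(ℝ, ℝ) f x f') (g : TangentSpace 𝓘(ℝ, E) x)
    (hg : ∀ v, inner ℝ g v = f' v) : riemGrad E f x = g := by
  refine ext_inner_right ℝ fun v => ?_
  rw [inner_riemGrad, h.mfderiv]
  exact (hg v).symm

theorem hasMFDerivAt_finiteSum {m : ℕ} {φ : Fin m → M → ℝ} {x : M}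
    (h : ∀ i, MDifferentiableAt 𝓘(ℝ, E) 𝓘(ℝ, ℝ) (φ i) x) :
    HasMFDerivAt 𝓘(ℝ, E) 𝓘(ℝ, ℝ) (finiteSum φ) x
      ((m : ℝ)⁻¹ • ∑ i, (mfderiv 𝓘(ℝ, E) 𝓘(ℝ, ℝ) (φ i) x : TangentSpace 𝓘(ℝ, E) x →L[ℝ] ℝ)) := by
  have h1 := HasMFDerivAt.sum (t := Finset.univ) fun i _ => (h i).hasMFDerivAt
  have h2 := h1.const_smul (m : ℝ)⁻¹
  have e : finiteSum φ = (m : ℝ)⁻¹ • ∑ i, φ i := by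
    funext y
    simp [finiteSum, div_eq_inv_mul]
  rw [e]
  exact h2

theorem riemGrad_finiteSum {m : ℕ} {φ : Fin m → M → ℝ} {x : M}
    (h : ∀ i, MDifferentiableAt 𝓘(ℝ, E) 𝓘(ℝ, ℝ) (φ i) x) :
    riemGrad E (finiteSum φ) x = meanVector fun i => riemGrad E (φ i) x := by
  refine riemGrad_eq_of_hasMFDerivAt (hasMFDerivAt_finiteSum h) _ fun v => ?_
  rw [meanVector, real_inner_smul_left, sum_inner]
  have key : ∀ T : Fin m → TangentSpace 𝓘(ℝ, E) x →L[ℝ] ℝ,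
      (m : ℝ)⁻¹ * ∑ i, T i v = ((m : ℝ)⁻¹ • ∑ i, T i) v := by simp
  simp only [inner_riemGrad]
  exact key _

theorem isParallelTransport_meanVector {n : ℕ} {x y : M} {v : Fin n → TangentSpace 𝓘(ℝ, E) x}
    {w : Fin n → TangentSpace 𝓘(ℝ, E) y} (h : ∀ i, IsParallelTransport x y (v i) (w i)) :
    IsParallelTransport x y (meanVector v) (meanVector w) := by
  have := (isParallelTransport_sum Finset.univ fun i _ => h i).smul_add
    isParallelTransport_zero (n : ℝ)⁻¹
  simpa only [add_zero, meanVector] using this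

theorem norm_meanVector_le {n : ℕ} {x : M} {v : Fin n → TangentSpace 𝓘(ℝ, E) x} {c : ℝ}
    (hn : 0 < n) (h : ∀ i, ‖v i‖ ≤ c) : ‖meanVector v‖ ≤ c := by
  have hn' : (0 : ℝ) < n := Nat.cast_pos.2 hn
  rw [meanVector, norm_smul, norm_inv, Real.norm_of_nonneg hn'.le, inv_mul_le_iff₀ hn']
  calc ‖∑ j, v j‖ ≤ ∑ j, ‖v j‖ := norm_sum_le _ _
    _ ≤ ∑ _j : Fin n, c := Finset.sum_le_sum fun i _ => h i
    _ = n * c := by simp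

theorem meanVector_sub {n : ℕ} {x : M} (v w : Fin n → TangentSpace 𝓘(ℝ, E) x) :
    meanVector (fun i => v i - w i) = meanVector v - meanVector w := by
  simp only [meanVector, Finset.sum_sub_distrib, smul_sub]

theorem isLSmoothOn_finiteSum {m : ℕ} (hm : 0 < m) {φ : Fin m → M → ℝ} {X : Set M} {L : ℝ}
    (h : ∀ i, IsLSmoothOn E X L (φ i)) : IsLSmoothOn E X L (finiteSum φ) := by
  refine ⟨fun x hx => (hasMFDerivAt_finiteSum fun i => (h i).1 x hx).mdifferentiableAt,
    fun x hx y hy => ?_⟩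
  choose w hw using fun i => (h i).2 x hx y hy
  rw [riemGrad_finiteSum fun i => (h i).1 x hx, riemGrad_finiteSum fun i => (h i).1 y hy]
  refine ⟨meanVector w, isParallelTransport_meanVector fun i => (hw i).1, ?_⟩
  rw [← meanVector_sub]
  exact norm_meanVector_le hm fun i => (hw i).2

theorem IsLSmoothOn.mono {X : Set M} {L L' : ℝ} {f : M → ℝ} (h : IsLSmoothOn E X L f)
    (hL : L ≤ L') : IsLSmoothOn E X L' f :=
  ⟨h.1, fun x hx y hy => (h.2 x hx y hy).imp fun _ hw =>
    ⟨hw.1, hw.2.trans (mul_le_mul_of_nonneg_right hL dist_nonneg)⟩⟩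

theorem norm_tangent_congr {p q : M} (h : p = q) (u : E) :
    norm (E := TangentSpace 𝓘(ℝ, E) p) u = norm (E := TangentSpace 𝓘(ℝ, E) q) u := by rw [h]

theorem velocity_congr {γ γ' : ℝ → M} (h : EqOn γ γ' (Icc 0 1)) {s : ℝ} (hs : s ∈ Icc (0 : ℝ) 1) :
    (velocity E γ s : E) = (velocity E γ' s : E) := by
  have e : ∀ {L L' : ℝ →L[ℝ] E}, L = L' → L 1 = L' 1 := by rintro _ _ rfl; rfl
  exact e (mfderivWithin_congr h (h hs))

section Convex

variable {X : Set M} (hX : IsGeodesicallyConvex E X) {x y : M} (hx : x ∈ X) (hy : y ∈ X)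
include hX hx hy

theorem IsGeodesicallyConvex.isMinimizingGeodesic :
    IsMinimizingGeodesic E x y (geodesicMap E x y) := by
  obtain ⟨γ, hγ, -⟩ := hX x hx y hy
  exact isMinimizingGeodesic_geodesicMap ⟨γ, hγ⟩

theorem IsGeodesicallyConvex.geodesicMap_mem {t : ℝ} (ht : t ∈ Icc (0 : ℝ) 1) :
    geodesicMap E x y t ∈ X := by
  obtain ⟨γ, hγ, hm, hu⟩ := hX x hx y hy
  rw [hu _ (hX.isMinimizingGeodesic hx hy) ht]
  exact hm t ht

theorem IsGeodesicallyConvex.norm_expInv : ‖expInv E x y‖ = dist x y := by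
  have h := hX.isMinimizingGeodesic hx hy
  exact (norm_tangent_congr (E := E) h.2.1 _).symm.trans
    (h.norm_velocity (left_mem_Icc.2 zero_le_one))

variable [IsRiemannianManifold 𝓘(ℝ, E) M]

/-- A rescaled initial piece of a minimizing geodesic is minimizing, hence is the unique one to the
intermediate point. Thus the transport from `x` to γ(t) in the smoothness hypothesis runs along γ
itself. -/
theorem IsGeodesicallyConvex.geodesicMap_eqOn {t : ℝ} (ht : t ∈ Icc (0 : ℝ) 1) :
    EqOn (geodesicMap E x (geodesicMap E x y t)) (fun r => geodesicMap E x y (t * r))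
      (Icc 0 1) := by
  have hmem := hX.geodesicMap_mem hx hy ht
  obtain ⟨γ, hγ, hm, hu⟩ := hX x hx _ hmem
  intro r hr
  rw [hu _ (hX.isMinimizingGeodesic hx hmem) hr,
    hu _ ((hX.isMinimizingGeodesic hx hy).comp_mul ht) hr]

/-- Transport grad f(x) along γ to w at γ(t). Since γ' is parallel too, ⟨w, γ'(t)⟩ = ⟨grad f(x),
γ'(0)⟩, and Cauchy-Schwarz bounds the rest by L t d(x,y) · d(x,y). The rescaled geodesic to γ(t)
carries a factor t, which is cancelled using t > 0. -/
theorem IsLSmoothOn.metricAt_velocity_le {L : ℝ} {f : M → ℝ} (hf : IsLSmoothOn E X L f) {t : ℝ}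
    (ht0 : 0 < t) (ht1 : t ≤ 1) :
    metricAt (geodesicMap E x y t) (riemGrad E f (geodesicMap E x y t))
      (velocity E (geodesicMap E x y) t) ≤
      metricAt x (riemGrad E f x) (expInv E x y) + L * dist x y ^ 2 * t := by
  have ht : t ∈ Icc (0 : ℝ) 1 := ⟨ht0.le, ht1⟩
  have h0 : (0 : ℝ) ∈ Icc (0 : ℝ) 1 := left_mem_Icc.2 zero_le_one
  have h1 : (1 : ℝ) ∈ Icc (0 : ℝ) 1 := right_mem_Icc.2 zero_le_one
  have hγ := hX.isMinimizingGeodesic hx hy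
  have hmem := hX.geodesicMap_mem hx hy ht
  have hσ := hX.isMinimizingGeodesic hx hmem
  have heq := hX.geodesicMap_eqOn hx hy ht
  obtain ⟨w, ⟨W, hW, hW0, hW1⟩, hw⟩ := hf.2 x hx _ hmem
  have hvel : ∀ s ∈ Icc (0 : ℝ) 1, (velocity E (geodesicMap E x (geodesicMap E x y t)) s : E) =
      t • (velocity E (geodesicMap E x y) (t * s) : E) := fun s hs =>
    (velocity_congr heq hs).trans (velocity_comp_mul hγ.1.mdifferentiableOn ht hs)
  have hsmul : ∀ (p : M) (u v v' : E), v' = t • v →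
      metricAt (E := E) p u v' = t * metricAt (E := E) p u v := by
    rintro p u v v' rfl
    exact real_inner_smul_right (F := TangentSpace 𝓘(ℝ, E) p) _ _ _
  have hpar := metricAt_eq_of_parallel hσ.1.mdifferentiableOn hW hσ.1.2 h1
  have e1 := hsmul (geodesicMap E x y t) w _ _ (hvel 1 h1)
  have e0 := hsmul x (riemGrad E f x) _ _ (hvel 0 h0)
  rw [mul_one] at e1
  rw [mul_zero] at e0
  have e2 : metricAt (geodesicMap E x y t) w (velocity E (geodesicMap E x y) t) =
      metricAt x (riemGrad E f x) (expInv E x y) := by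
    subst hW1
    have a1 := metricAt_congr (E := E) hσ.2.2.1 (W 1)
      (velocity E (geodesicMap E x (geodesicMap E x y t)) 1)
    have a0 := metricAt_congr (E := E) hσ.2.1 (W 0)
      (velocity E (geodesicMap E x (geodesicMap E x y t)) 0)
    have hW0' : (W 0 : E) = (riemGrad E f x : E) := hW0
    have b0 : metricAt (E := E) x (W 0 : E) (velocity E (geodesicMap E x (geodesicMap E x y t)) 0) =
      metricAt (E := E) x (riemGrad E f x)
        (velocity E (geodesicMap E x (geodesicMap E x y t)) 0) :=
      congrArg (fun u : E => metricAt (E := E) x u _) hW0'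
    have := (e1.symm.trans (a1.symm.trans (hpar.trans (a0.trans (b0.trans e0)))))
    exact mul_left_cancel₀ ht0.ne' this
  rw [← e2]
  have e3 : metricAt (geodesicMap E x y t) (riemGrad E f (geodesicMap E x y t))
      (velocity E (geodesicMap E x y) t) -
      metricAt (geodesicMap E x y t) w (velocity E (geodesicMap E x y) t) ≤
      ‖riemGrad E f (geodesicMap E x y t) - w‖ * ‖velocity E (geodesicMap E x y) t‖ := by
    have : ∀ (p : M) (u w v : TangentSpace 𝓘(ℝ, E) p),
        metricAt p u v - metricAt p w v ≤ ‖u - w‖ * ‖v‖ := fun p u w v => by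
      have := real_inner_le_norm (u - w) v
      rwa [inner_sub_left] at this
    exact this _ _ _ _
  rw [hγ.norm_velocity ht] at e3
  rw [hγ.dist_eq ht] at hw
  have := mul_le_mul_of_nonneg_right hw (dist_nonneg (x := x) (y := y))
  linarith

/-- The bound on (f ∘ γ)' makes f ∘ γ minus the quadratic model antitone on [0, 1]; only interior
times are needed for this. -/
theorem IsLSmoothOn.descent {L : ℝ} {f : M → ℝ} (hf : IsLSmoothOn E X L f) {t : ℝ}
    (ht : t ∈ Icc (0 : ℝ) 1) :
    f (geodesicMap E x y t) ≤
      f x + t * inner ℝ (riemGrad E f x) (expInv E x y) + L / 2 * dist x y ^ 2 * t ^ 2 := by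
  have hγ := hX.isMinimizingGeodesic hx hy
  have hd : ∀ s ∈ Icc (0 : ℝ) 1, HasDerivWithinAt (fun r => f (geodesicMap E x y r))
      (metricAt (geodesicMap E x y s) (riemGrad E f (geodesicMap E x y s))
        (velocity E (geodesicMap E x y) s)) (Icc 0 1) s := by
    intro s hs
    have h1 := (hf.1 _ (hX.geodesicMap_mem hx hy hs)).hasMFDerivAt
    have h2 := (hγ.1.mdifferentiableOn s hs).hasMFDerivWithinAt
    have key : ∀ {g : ℝ → ℝ} {T : ℝ →L[ℝ] ℝ} {S : Set ℝ}, HasFDerivWithinAt g T S s →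
        HasDerivWithinAt g (T 1) S s := fun h => h.hasDerivWithinAt
    rw [metricAt, inner_riemGrad]
    exact key (h1.comp_hasMFDerivWithinAt s h2).hasFDerivWithinAt
  set a := metricAt x (riemGrad E f x) (expInv E x y) with ha
  have hanti : AntitoneOn (fun s => f (geodesicMap E x y s) -
      (s * a + L / 2 * dist x y ^ 2 * s ^ 2)) (Icc 0 1) := by
    have hd2 : ∀ s ∈ Icc (0 : ℝ) 1, HasDerivWithinAt (fun s => f (geodesicMap E x y s) -
      (s * a + L / 2 * dist x y ^ 2 * s ^ 2)) _ (Icc 0 1) s := fun s hs =>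
      (hd s hs).sub ((((hasDerivAt_id s).mul_const a).add
        (((hasDerivAt_pow 2 s)).const_mul (L / 2 * dist x y ^ 2))).hasDerivWithinAt)
    refine antitoneOn_of_deriv_nonpos (convex_Icc 0 1)
      (fun s hs => (hd2 s hs).continuousWithinAt) ?_ ?_
    · rw [interior_Icc]
      exact fun s hs => ((hd2 s (Ioo_subset_Icc_self hs)).hasDerivAt
        (Icc_mem_nhds hs.1 hs.2)).differentiableAt.differentiableWithinAt
    · rw [interior_Icc]
      intro s hs
      rw [((hd2 s (Ioo_subset_Icc_self hs)).hasDerivAt (Icc_mem_nhds hs.1 hs.2)).deriv]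
      have := hf.metricAt_velocity_le hX hx hy hs.1 hs.2.le
      simp only [Nat.cast_ofNat, Nat.add_one_sub_one, pow_one]
      linarith
  have h := hanti (left_mem_Icc.2 zero_le_one) ht ht.1
  simp only [hγ.2.1] at h
  have hai : a = inner ℝ (riemGrad E f x) (expInv E x y) := rfl
  rw [← hai]
  linarith

end Convex

section Gap

variable {X : Set M} (hX : IsGeodesicallyConvex E X) {x : M} (hx : x ∈ X) {D : ℝ}
  (hD : ∀ p ∈ X, ∀ q ∈ X, dist p q ≤ D) (f : M → ℝ)
include hX hx hD

/-- The oracle point is optimal for `g`. Passing between `g` and the true gradient costs their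
difference paired with a difference of two inverse exponentials, each of norm at most D; hence the
factor 2D. -/
theorem fwGap_le_of_oracle {lin : (x : M) → TangentSpace 𝓘(ℝ, E) x → M}
    (hlin : IsLinearOracle X lin) (g : TangentSpace 𝓘(ℝ, E) x) :
    fwGap E X f x ≤ -inner ℝ (riemGrad E f x) (expInv E x (lin x g)) +
      2 * D * ‖riemGrad E f x - g‖ := by
  obtain ⟨hz, hopt⟩ := hlin x hx g
  refine csSup_le (nonempty_of_mem (mem_image_of_mem _ hx)) ?_
  rintro _ ⟨y, hy, rfl⟩
  have h1 := hopt y hy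
  have h2 := real_inner_le_norm (riemGrad E f x - g) (expInv E x (lin x g) - expInv E x y)
  have h3 : ‖expInv E x (lin x g) - expInv E x y‖ ≤ 2 * D := by
    refine (norm_sub_le _ _).trans ?_
    rw [hX.norm_expInv hx hy, hX.norm_expInv hx hz]
    linarith [hD x hx y hy, hD x hx _ hz]
  have h4 := mul_le_mul_of_nonneg_left h3 (norm_nonneg (riemGrad E f x - g))
  simp only [inner_sub_left, inner_sub_right] at h2
  simp only [inner_neg_right]
  rw [real_inner_comm]
  linarith

theorem frankWolfe_progress [IsRiemannianManifold 𝓘(ℝ, E) M] {f : M → ℝ} {L η : ℝ} (hL : 0 ≤ L)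
    (hf : IsLSmoothOn E X L f)
    (hη : η ∈ Icc (0 : ℝ) 1) {lin : (x : M) → TangentSpace 𝓘(ℝ, E) x → M}
    (hlin : IsLinearOracle X lin) (g : TangentSpace 𝓘(ℝ, E) x) :
    η * fwGap E X f x + f (geodesicMap E x (lin x g) η) ≤
      f x + 2 * D * η * ‖riemGrad E f x - g‖ + L / 2 * D ^ 2 * η ^ 2 := by
  have hz := (hlin x hx g).1
  have h1 := hf.descent hX hx hz hη
  have h2 := mul_le_mul_of_nonneg_left (fwGap_le_of_oracle hX hx hD f hlin g) hη.1
  have h3 : dist x (lin x g) ^ 2 ≤ D ^ 2 :=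
    pow_le_pow_left₀ dist_nonneg (hD x hx _ hz) 2
  have h4 := mul_le_mul_of_nonneg_left h3 (mul_nonneg hL (sq_nonneg η))
  linarith

end Gap

end FrankWolfeLemmas

/-! ### Expectation, reachable values and exact costs of oracle programs -/

noncomputable section ProgramLemmas

namespace OracleProgram

variable {E : Type*} [NormedAddCommGroup E] [NormedSpace ℝ E] [FiniteDimensional ℝ E]
  {M : Type*} [MetricSpace M] [ChartedSpace E M] [IsManifold 𝓘(ℝ, E) ∞ M]
  [RiemannianBundle (fun x : M => TangentSpace 𝓘(ℝ, E) x)] {m : ℕ}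
  {α β : Type*}

section Semantics

variable (φ : Fin m → M → ℝ) (lin : (x : M) → TangentSpace 𝓘(ℝ, E) x → M)

/-- The expectation of `h` at the returned value. -/
def expect : OracleProgram E M m α → (α → ℝ) → ℝ
  | done a, h => h a
  | ifo i x next, h => expect (next (φ i x, riemGrad E (φ i) x)) h
  | rlo x g next, h => expect (next (lin x g)) h
  | sample n _ next, h => (∑ i, expect (next i) h) / n

/-- Every value that can be returned satisfies `P`. -/
def Returns : OracleProgram E M m α → (α → Prop) → Prop
  | done a, P => P a
  | ifo i x next, P => Returns (next (φ i x, riemGrad E (φ i) x)) P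
  | rlo x g next, P => Returns (next (lin x g)) P
  | sample _ _ next, P => ∀ i, Returns (next i) P

/-- Every run makes exactly `a` calls of the first-order oracle and `b` calls of the linear
optimization oracle. -/
def HasCost : OracleProgram E M m α → ℕ → ℕ → Prop
  | done _, a, b => a = 0 ∧ b = 0
  | ifo i x next, a, b => ∃ a', a = a' + 1 ∧ HasCost (next (φ i x, riemGrad E (φ i) x)) a' b
  | rlo x g next, a, b => ∃ b', b = b' + 1 ∧ HasCost (next (lin x g)) a b'
  | sample _ _ next, a, b => ∀ i, HasCost (next i) a b

end Semantics

variable {φ : Fin m → M → ℝ} {lin : (x : M) → TangentSpace 𝓘(ℝ, E) x → M}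

theorem hasSum_run (p : OracleProgram E M m α) (h : α → ℝ) :
    HasSum (fun r : Outcome α => (p.run φ lin r).toReal * h r.value) (p.expect φ lin h) := by
  -- Incrementing a call counter is injective and keeps the returned value, so pushing the law
  -- forward only reindexes the sum.
  have hmap : ∀ (q : PMF (Outcome α)) (T : Outcome α → Outcome α), Function.Injective T →
      (∀ r, (T r).value = r.value) → ∀ e : ℝ,
      HasSum (fun r : Outcome α => (q r).toReal * h r.value) e →
      HasSum (fun r : Outcome α => (q.map T r).toReal * h r.value) e := by
    intro q T hT hval e he
    refine (hT.hasSum_iff fun r hr => ?_).1 ?_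
    · have : q.map T r = 0 := by
        rw [PMF.apply_eq_zero_iff, PMF.support_map]
        rintro ⟨s, -, rfl⟩
        exact hr ⟨s, rfl⟩
      simp [this]
    · convert he using 2 with r
      have : q.map T (T r) = q r := by
        rw [PMF.map_apply, tsum_eq_single r fun s hs => if_neg fun hrs => hs (hT hrs).symm,
          if_pos rfl]
      simp only [Function.comp_apply, this, hval]
  induction p with
  | done a =>
    have h1 := hasSum_single (f := fun r : Outcome α =>
      ((done a : OracleProgram E M m α).run φ lin r).toReal * h r.value) ⟨a, 0, 0⟩ fun r hr => by
        simp [run, PMF.pure_apply, hr]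
    simpa [run, PMF.pure_apply, expect] using h1
  | ifo i x next ih =>
    simp only [run, expect]
    refine hmap ((next (φ i x, riemGrad E (φ i) x)).run φ lin)
      (fun r => ⟨r.value, r.ifoCalls + 1, r.rloCalls⟩) (fun r s hrs => ?_) (fun _ => rfl) _ (ih _)
    cases r; cases s
    simpa using hrs
  | rlo x g next ih =>
    simp only [run, expect]
    refine hmap ((next (lin x g)).run φ lin)
      (fun r => ⟨r.value, r.ifoCalls, r.rloCalls + 1⟩) (fun r s hrs => ?_) (fun _ => rfl) _ (ih _)
    cases r; cases s
    simpa using hrs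
  | sample n hn next ih =>
    have h1 := (hasSum_sum (s := Finset.univ) fun i _ => ih i).div_const (n : ℝ)
    have : Nonempty (Fin n) := ⟨⟨0, hn⟩⟩
    refine (congrArg (HasSum · _) (funext fun r => ?_)).mpr h1
    rw [run.eq_def, PMF.bind_apply, tsum_fintype, ENNReal.toReal_sum fun i _ =>
      ENNReal.mul_ne_top (PMF.apply_ne_top _ _) (PMF.apply_ne_top _ _), Finset.sum_mul,
      Finset.sum_div]
    refine Finset.sum_congr rfl fun i _ => ?_
    simp only [PMF.uniformOfFintype_apply, Fintype.card_fin, ENNReal.toReal_mul,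
      ENNReal.toReal_inv, ENNReal.toReal_natCast]
    ring

theorem HasCost.eq_of_mem_support {p : OracleProgram E M m α} {a b : ℕ}
    (hp : p.HasCost φ lin a b) {r : Outcome α} (hr : r ∈ (p.run φ lin).support) :
    r.ifoCalls = a ∧ r.rloCalls = b := by
  induction p generalizing a b r with
  | done v =>
    rw [run, PMF.mem_support_pure_iff] at hr
    subst hr
    exact ⟨hp.1.symm, hp.2.symm⟩
  | ifo i x next ih =>
    rw [run, PMF.support_map] at hr
    obtain ⟨s, hs, rfl⟩ := hr
    obtain ⟨a', rfl, ha'⟩ := hp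
    obtain ⟨h1, h2⟩ := ih _ ha' hs
    exact ⟨congrArg (· + 1) h1, h2⟩
  | rlo x g next ih =>
    rw [run, PMF.support_map] at hr
    obtain ⟨s, hs, rfl⟩ := hr
    obtain ⟨b', rfl, hb'⟩ := hp
    obtain ⟨h1, h2⟩ := ih _ hb' hs
    exact ⟨h1, congrArg (· + 1) h2⟩
  | sample n hn next ih =>
    rw [run, PMF.mem_support_bind_iff] at hr
    obtain ⟨i, -, hi⟩ := hr
    exact ih i (hp i) hi

theorem expect_bind (p : OracleProgram E M m α) (f : α → OracleProgram E M m β) (h : β → ℝ) :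
    (p.bind f).expect φ lin h = p.expect φ lin fun a => (f a).expect φ lin h := by
  induction p with
  | done a => rfl
  | ifo i x next ih => exact ih _
  | rlo x g next ih => exact ih _
  | sample n hn next ih => simp only [bind, expect, ih]

theorem expect_add (p : OracleProgram E M m α) (h h' : α → ℝ) :
    (p.expect φ lin fun a => h a + h' a) = p.expect φ lin h + p.expect φ lin h' := by
  induction p with
  | done a => rfl
  | ifo i x next ih => exact ih _
  | rlo x g next ih => exact ih _
  | sample n hn next ih => simp only [expect, ih, Finset.sum_add_distrib, add_div]

theorem expect_const_mul (p : OracleProgram E M m α) (c : ℝ) (h : α → ℝ) :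
    (p.expect φ lin fun a => c * h a) = c * p.expect φ lin h := by
  induction p with
  | done a => rfl
  | ifo i x next ih => exact ih _
  | rlo x g next ih => exact ih _
  | sample n hn next ih => simp only [expect, ih, ← Finset.mul_sum, mul_div_assoc]

theorem expect_const (p : OracleProgram E M m α) (c : ℝ) : (p.expect φ lin fun _ => c) = c := by
  induction p with
  | done a => rfl
  | ifo i x next ih => exact ih _
  | rlo x g next ih => exact ih _
  | sample n hn next ih =>
    have : (n : ℝ) ≠ 0 := Nat.cast_ne_zero.2 hn.ne'
    simp only [expect, ih, Finset.sum_const, Finset.card_univ, Fintype.card_fin, nsmul_eq_mul]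
    field_simp

theorem Returns.expect_le {p : OracleProgram E M m α} {P : α → Prop} (hp : p.Returns φ lin P)
    {h h' : α → ℝ} (hh : ∀ a, P a → h a ≤ h' a) : p.expect φ lin h ≤ p.expect φ lin h' := by
  induction p with
  | done a => exact hh a hp
  | ifo i x next ih => exact ih _ hp
  | rlo x g next ih => exact ih _ hp
  | sample n hn next ih =>
    exact div_le_div_of_nonneg_right (Finset.sum_le_sum fun i _ => ih i (hp i)) n.cast_nonneg

theorem returns_true (p : OracleProgram E M m α) : p.Returns φ lin fun _ => True := by
  induction p with
  | done a => trivial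
  | ifo i x next ih => exact ih _
  | rlo x g next ih => exact ih _
  | sample n hn next ih => exact ih

theorem expect_mono (p : OracleProgram E M m α) {h h' : α → ℝ} (hh : ∀ a, h a ≤ h' a) :
    p.expect φ lin h ≤ p.expect φ lin h' :=
  p.returns_true.expect_le fun a _ => hh a

theorem Returns.bind {p : OracleProgram E M m α} {P : α → Prop} (hp : p.Returns φ lin P)
    {f : α → OracleProgram E M m β} {Q : β → Prop} (hf : ∀ a, P a → (f a).Returns φ lin Q) :
    (p.bind f).Returns φ lin Q := by
  induction p with
  | done a => exact hf a hp
  | ifo i x next ih => exact ih _ hp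
  | rlo x g next ih => exact ih _ hp
  | sample n hn next ih => exact fun i => ih i (hp i)

theorem HasCost.bind {p : OracleProgram E M m α} {a b c d : ℕ} (hp : p.HasCost φ lin a b)
    {f : α → OracleProgram E M m β} (hf : ∀ v, (f v).HasCost φ lin c d) :
    (p.bind f).HasCost φ lin (a + c) (b + d) := by
  induction p generalizing a b with
  | done v =>
    obtain ⟨rfl, rfl⟩ := hp
    rw [zero_add, zero_add]
    exact hf v
  | ifo i x next ih =>
    obtain ⟨a', rfl, ha'⟩ := hp
    exact ⟨a' + c, by ring, ih _ ha'⟩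
  | rlo x g next ih =>
    obtain ⟨b', rfl, hb'⟩ := hp
    exact ⟨b' + d, by ring, ih _ hb'⟩
  | sample n hn next ih => exact fun i => ih i (hp i)

theorem HasCost.bind_done {p : OracleProgram E M m α} {a b : ℕ} (hp : p.HasCost φ lin a b)
    (f : α → β) : (p.bind fun v => done (f v)).HasCost φ lin a b :=
  hp.bind (c := 0) (d := 0) fun _ => ⟨rfl, rfl⟩

theorem HasCost.collect {n : ℕ} {f : Fin n → OracleProgram E M m β} {a b : ℕ}
    (hf : ∀ i, (f i).HasCost φ lin a b) : (collect n f).HasCost φ lin (n * a) (n * b) := by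
  induction n with
  | zero => exact ⟨by simp, by simp⟩
  | succ n ih =>
    have := (hf 0).bind fun v => (ih (f := fun i => f i.succ) fun i => hf i.succ).bind_done
      (Fin.cons (α := fun _ => β) v)
    rwa [add_comm a, add_comm b, ← add_one_mul, ← add_one_mul] at this

theorem expect_collect_succ {n : ℕ} (f : Fin (n + 1) → OracleProgram E M m β)
    (h : (Fin (n + 1) → β) → ℝ) :
    (collect (n + 1) f).expect φ lin h = (f 0).expect φ lin fun a =>
      (collect n fun i => f i.succ).expect φ lin fun r => h (Fin.cons a r) := by
  simp only [collect, expect_bind, expect]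

theorem expect_collect_of_deterministic {n : ℕ} {f : Fin n → OracleProgram E M m β} {v : Fin n → β}
    (hf : ∀ i h, (f i).expect φ lin h = h (v i)) (h : (Fin n → β) → ℝ) :
    (collect n f).expect φ lin h = h v := by
  induction n with
  | zero => exact congrArg h (Subsingleton.elim _ _)
  | succ n ih =>
    rw [expect_collect_succ, hf, ih (v := fun i => v i.succ) fun i => hf i.succ]
    exact congrArg h (Fin.cons_self_tail v)

/-- The variance of a sum of independent copies is the sum of the variances. -/
theorem expect_collect_norm_sq_le {V : Type*} [NormedAddCommGroup V] [InnerProductSpace ℝ V]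
    {p : OracleProgram E M m V} {μ : V} {σ : ℝ}
    (hmean : ∀ c : V, (p.expect φ lin fun v => inner ℝ c (v - μ)) = 0)
    (hvar : (p.expect φ lin fun v => ‖v - μ‖ ^ 2) ≤ σ) (n : ℕ) (c : V) :
    ((collect n fun _ => p).expect φ lin fun v => ‖c + ∑ i, (v i - μ)‖ ^ 2) ≤
      ‖c‖ ^ 2 + n * σ := by
  -- The vector `c` accumulates the deviations already drawn; the cross term with the next,
  -- independent draw vanishes by `hmean`.
  induction n generalizing c with
  | zero => simp [collect, expect]
  | succ n ih =>
    rw [expect_collect_succ]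
    simp only [Fin.sum_univ_succ, Fin.cons_zero, Fin.cons_succ, ← add_assoc]
    calc _ ≤ p.expect φ lin fun a => ‖c + (a - μ)‖ ^ 2 + n * σ := expect_mono _ fun a => ih _
      _ = (p.expect φ lin fun a => (‖c‖ ^ 2 + 2 * inner ℝ c (a - μ)) + ‖a - μ‖ ^ 2) + n * σ := by
        rw [expect_add, expect_const]
        simp only [norm_add_sq_real]
      _ = ‖c‖ ^ 2 + (p.expect φ lin fun v => ‖v - μ‖ ^ 2) + n * σ := by
        rw [expect_add, expect_add, expect_const, expect_const_mul, hmean, mul_zero, add_zero]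
      _ ≤ _ := by push_cast; linarith

/-- Jensen's inequality for the square, obtained from the pointwise bound h ≤ τ/2 + h²/(2τ). -/
theorem expect_le_of_expect_sq_le {p : OracleProgram E M m α} {h : α → ℝ} {τ : ℝ} (hτ : 0 < τ)
    (hp : (p.expect φ lin fun a => h a ^ 2) ≤ τ ^ 2) : p.expect φ lin h ≤ τ := by
  have h1 : p.expect φ lin h ≤ p.expect φ lin fun a => τ / 2 + (2 * τ)⁻¹ * h a ^ 2 := by
    refine expect_mono _ fun a => ?_
    have : τ / 2 + (2 * τ)⁻¹ * h a ^ 2 - h a = (2 * τ)⁻¹ * (h a - τ) ^ 2 := by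
      field_simp; ring
    have h2 : 0 ≤ (2 * τ)⁻¹ * (h a - τ) ^ 2 := by positivity
    linarith
  rw [expect_add, expect_const, expect_const_mul] at h1
  have h2 : (2 * τ)⁻¹ * (p.expect φ lin fun a => h a ^ 2) ≤ (2 * τ)⁻¹ * τ ^ 2 :=
    mul_le_mul_of_nonneg_left hp (by positivity)
  have h3 : (2 * τ)⁻¹ * τ ^ 2 = τ / 2 := by field_simp
  linarith

end OracleProgram

end ProgramLemmas

/-! ### Cost, variance and convergence of SVR-RFW -/

noncomputable section SvrRfwAnalysis

open OracleProgram

variable {E : Type*} [NormedAddCommGroup E] [NormedSpace ℝ E] [FiniteDimensional ℝ E]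
  {M : Type*} [MetricSpace M] [ChartedSpace E M] [IsManifold 𝓘(ℝ, E) ∞ M]
  [RiemannianBundle (fun x : M => TangentSpace 𝓘(ℝ, E) x)] {m : ℕ}
  {φ : Fin m → M → ℝ} {lin : (x : M) → TangentSpace 𝓘(ℝ, E) x → M} (hm : 0 < m)

/-! ### Oracle costs -/

theorem hasCost_componentGradients (x₀ : M) :
    (componentGradients E m x₀).HasCost φ lin m 0 := by
  have := HasCost.collect (φ := φ) (lin := lin) (a := 1) (b := 0)
    (f := fun i : Fin m => ifo i x₀ fun r => done r.2) fun i => ⟨0, rfl, rfl, rfl⟩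
  rwa [mul_one, mul_zero] at this

theorem hasCost_gradientEstimate (x₀ : M) (G : Fin m → TangentSpace 𝓘(ℝ, E) x₀) (b : ℕ) (x : M) :
    (gradientEstimate hm x₀ G b x).HasCost φ lin b 0 := by
  have := HasCost.collect (φ := φ) (lin := lin) (n := b) (a := 1) (b := 0)
    (f := fun _ : Fin b => sample m hm fun j => ifo j x fun r =>
      done (r.2 - parallelTransport x₀ x (G j - meanVector G))) fun _ _ => ⟨0, rfl, rfl, rfl⟩
  rw [mul_one, mul_zero] at this
  exact this.bind_done _

theorem hasCost_frankWolfeStep (x₀ : M) (G : Fin m → TangentSpace 𝓘(ℝ, E) x₀) (b : ℕ) (η : ℝ)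
    (x : M) : (frankWolfeStep hm x₀ G b η x).HasCost φ lin b 1 :=
  (hasCost_gradientEstimate hm x₀ G b x).bind (c := 0) (d := 1) fun _ => ⟨0, rfl, rfl, rfl⟩

theorem hasCost_epochSteps (x₀ : M) (G : Fin m → TangentSpace 𝓘(ℝ, E) x₀) (b : ℕ) (η : ℝ)
    (k : ℕ) (x : M) : (epochSteps hm x₀ G b η k x).HasCost φ lin (k * b) k := by
  induction k generalizing x with
  | zero => exact ⟨zero_mul b, rfl⟩
  | succ k ih =>
    have := (hasCost_frankWolfeStep (φ := φ) (lin := lin) hm x₀ G b η x).bind fun x' =>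
      (ih x').bind_done fun r => (x :: r.1, r.2)
    convert this using 1
    · rfl
    · ring
    · ring

theorem hasCost_epochs (K b : ℕ) (η : ℝ) (s : ℕ) (x₀ : M) :
    (epochs E hm K b η s x₀).HasCost φ lin (s * (m + K * b)) (s * K) := by
  induction s generalizing x₀ with
  | zero => exact ⟨zero_mul _, zero_mul _⟩
  | succ s ih =>
    have := (hasCost_componentGradients (φ := φ) (lin := lin) x₀).bind fun G =>
      (hasCost_epochSteps hm x₀ G b η K x₀).bind fun r => (ih r.2).bind_done (r.1 ++ ·)
    convert this using 1
    · rfl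
    · ring
    · ring

theorem hasCost_svrRfw (S K b : ℕ) (η : ℝ) (x₀ : M) :
    (svrRfw E hm S K b η x₀).HasCost φ lin (S * (m + K * b)) (S * K) := by
  refine (hasCost_epochs hm K b η S x₀).bind (c := 0) (d := 0) fun l => ?_
  split_ifs with h
  · exact fun _ => ⟨rfl, rfl⟩
  · exact ⟨rfl, rfl⟩

/-! ### The variance of the gradient estimate -/

theorem expect_componentGradients (x₀ : M) (h : (Fin m → TangentSpace 𝓘(ℝ, E) x₀) → ℝ) :
    (componentGradients E m x₀).expect φ lin h = h fun i => riemGrad E (φ i) x₀ :=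
  expect_collect_of_deterministic (fun _ _ => rfl) h

/-- Centring lowers the sum of squares by m times the squared norm of the mean. -/
theorem sum_norm_sub_mean_sq_le {V : Type*} [NormedAddCommGroup V] [InnerProductSpace ℝ V]
    (hm : 0 < m) (a : Fin m → V) :
    ∑ j, ‖a j - (m : ℝ)⁻¹ • ∑ i, a i‖ ^ 2 ≤ ∑ j, ‖a j‖ ^ 2 := by
  have hm' : (m : ℝ) ≠ 0 := Nat.cast_ne_zero.2 hm.ne'
  set s := (m : ℝ)⁻¹ • ∑ i, a i with hs
  have h1 : ∑ i, a i = (m : ℝ) • s := by rw [hs, smul_inv_smul₀ hm']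
  simp only [norm_sub_sq_real, Finset.sum_add_distrib, Finset.sum_sub_distrib, ← Finset.mul_sum,
    ← sum_inner, h1, real_inner_smul_left, real_inner_self_eq_norm_sq]
  simp only [Finset.sum_const, Finset.card_univ, Fintype.card_fin, nsmul_eq_mul]
  have : 0 ≤ (m : ℝ) * ‖s‖ ^ 2 := by positivity
  linarith

variable [IsContMDiffRiemannianBundle 𝓘(ℝ, E) ∞ E (fun x : M => TangentSpace 𝓘(ℝ, E) x)]
  {X : Set M} (hX : IsGeodesicallyConvex E X) {L : ℝ} (hφ : ∀ i, IsLSmoothOn E X L (φ i))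

include hX hφ in
-- With w_j the transport of grad φ_j(x₀) and a_j = grad φ_j(x) - w_j, linearity of transport shows
-- that a draw deviates from grad Φ(x) by a_j minus the mean of the a's. This is centred, and ‖a_j‖
-- ≤ L d(x₀,x).
theorem expect_gradientEstimate_norm_sq_le {x₀ x : M} (hx₀ : x₀ ∈ X) (hx : x ∈ X) {b : ℕ}
    (hb : 0 < b) :
    ((gradientEstimate hm x₀ (fun i => riemGrad E (φ i) x₀) b x).expect φ lin fun g =>
      ‖riemGrad E (finiteSum φ) x - g‖ ^ 2) ≤ (L * dist x₀ x) ^ 2 / b := by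
  have hm' : (0 : ℝ) < m := Nat.cast_pos.2 hm
  have hb' : (0 : ℝ) < b := Nat.cast_pos.2 hb
  have hgeo : ∃ γ, IsMinimizingGeodesic E x₀ x γ := ⟨_, hX.isMinimizingGeodesic hx₀ hx⟩
  choose w hw hLw using fun i => (hφ i).2 x₀ hx₀ x hx
  let a : Fin m → TangentSpace 𝓘(ℝ, E) x := fun j => riemGrad E (φ j) x - w j
  set μ := riemGrad E (finiteSum φ) x with hμ
  have hμ' : μ = meanVector fun j => riemGrad E (φ j) x :=
    riemGrad_finiteSum fun i => (hφ i).1 x hx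
  let u : Fin m → TangentSpace 𝓘(ℝ, E) x := fun j => riemGrad E (φ j) x -
    parallelTransport x₀ x (riemGrad E (φ j) x₀ - meanVector fun i => riemGrad E (φ i) x₀)
  have hu : ∀ j, u j - μ = a j - meanVector a := by
    intro j
    have h1 := (isParallelTransport_meanVector hw).smul_add (hw j) (-1)
    have h2 : parallelTransport x₀ x (riemGrad E (φ j) x₀ - meanVector fun i => riemGrad E (φ i) x₀)
        = w j - meanVector w := by
      have h3 := h1.parallelTransport_eq hgeo
      rwa [neg_one_smul, neg_one_smul, neg_add_eq_sub, neg_add_eq_sub] at h3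
    have h4 : meanVector a = μ - meanVector w := by rw [hμ', ← meanVector_sub]
    simp only [u, h2, h4, a]
    abel
  let p : OracleProgram E M m (TangentSpace 𝓘(ℝ, E) x) := sample m hm fun j => ifo j x fun r =>
    done (r.2 - parallelTransport x₀ x
      (riemGrad E (φ j) x₀ - meanVector fun i => riemGrad E (φ i) x₀))
  have hp : ∀ h, p.expect φ lin h = (∑ j, h (u j)) / m := fun h => rfl
  have hmean : ∀ c : TangentSpace 𝓘(ℝ, E) x, (p.expect φ lin fun v => inner ℝ c (v - μ)) = 0 := by
    intro c
    have h1 : ∑ j, (a j - meanVector a) = 0 := by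
      rw [Finset.sum_sub_distrib, Finset.sum_const, Finset.card_univ, Fintype.card_fin,
        ← Nat.cast_smul_eq_nsmul ℝ, meanVector, smul_inv_smul₀ hm'.ne', sub_self]
    simp only [hp, hu, ← inner_sum, h1, inner_zero_right, zero_div]
  have hvar : (p.expect φ lin fun v => ‖v - μ‖ ^ 2) ≤ (L * dist x₀ x) ^ 2 := by
    simp only [hp, hu]
    rw [div_le_iff₀ hm']
    refine (sum_norm_sub_mean_sq_le hm a).trans ?_
    calc ∑ j, ‖a j‖ ^ 2 ≤ ∑ _j : Fin m, (L * dist x₀ x) ^ 2 :=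
          Finset.sum_le_sum fun j _ => pow_le_pow_left₀ (norm_nonneg _) (hLw j) 2
      _ = _ := by simp [mul_comm]
  have h1 := expect_collect_norm_sq_le hmean hvar b 0
  have h2 : ∀ v : Fin b → TangentSpace 𝓘(ℝ, E) x,
      ‖μ - meanVector v‖ ^ 2 = ((b : ℝ) ^ 2)⁻¹ * ‖0 + ∑ i, (v i - μ)‖ ^ 2 := by
    intro v
    have h3 : μ - meanVector v = -((b : ℝ)⁻¹ • (0 + ∑ i, (v i - μ))) := by
      rw [zero_add, Finset.sum_sub_distrib, Finset.sum_const, Finset.card_univ, Fintype.card_fin,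
        ← Nat.cast_smul_eq_nsmul ℝ, smul_sub, inv_smul_smul₀ hb'.ne', neg_sub, meanVector]
    rw [h3, norm_neg, norm_smul, mul_pow, norm_inv, Real.norm_of_nonneg hb'.le, inv_pow]
  have h4 : ((gradientEstimate hm x₀ (fun i => riemGrad E (φ i) x₀) b x).expect φ lin fun g =>
      ‖μ - g‖ ^ 2) = (collect b fun _ => p).expect φ lin fun v => ‖μ - meanVector v‖ ^ 2 :=
    expect_bind _ _ _
  rw [h4]
  simp only [h2, expect_const_mul]
  have h5 : (0 : ℝ) ≤ ((b : ℝ) ^ 2)⁻¹ := by positivity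
  refine (mul_le_mul_of_nonneg_left h1 h5).trans (le_of_eq ?_)
  rw [norm_zero]
  field_simp
  ring

/-! ### Convergence -/

variable [IsRiemannianManifold 𝓘(ℝ, E) M] {D : ℝ} (hD0 : 0 < D) (hL0 : 0 < L)
  (hD : ∀ p ∈ X, ∀ q ∈ X, dist p q ≤ D) (hlin : IsLinearOracle X lin)
  {η : ℝ} (hη0 : 0 < η) (hη1 : η ≤ 1)

include hX hD hlin hη0 hη1 in
theorem returns_frankWolfeStep (x₀ : M) (G : Fin m → TangentSpace 𝓘(ℝ, E) x₀) (b : ℕ) {x : M}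
    (hx : x ∈ X) :
    (frankWolfeStep hm x₀ G b η x).Returns φ lin fun x' => x' ∈ X ∧ dist x x' ≤ η * D := by
  refine (returns_true _).bind fun g _ => ?_
  have hz := (hlin x hx g).1
  refine ⟨hX.geodesicMap_mem hx hz ⟨hη0.le, hη1⟩, ?_⟩
  rw [(hX.isMinimizingGeodesic hx hz).dist_eq ⟨hη0.le, hη1⟩]
  exact mul_le_mul_of_nonneg_left (hD x hx _ hz) hη0.le

include hX hD hlin hη0 hη1 in
theorem returns_epochSteps (x₀ : M) (G : Fin m → TangentSpace 𝓘(ℝ, E) x₀) (b k : ℕ) {x : M}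
    (hx : x ∈ X) :
    (epochSteps hm x₀ G b η k x).Returns φ lin fun r => r.2 ∈ X ∧ r.1.length = k := by
  induction k generalizing x with
  | zero => exact ⟨hx, rfl⟩
  | succ k ih =>
    exact (returns_frankWolfeStep hm hX hD hlin hη0 hη1 x₀ G b hx).bind fun x' hx' =>
      (ih hx'.1).bind fun r hr => ⟨hr.1, congrArg (· + 1) hr.2⟩

include hX hD hlin hη0 hη1 in
theorem returns_epochs (K b s : ℕ) {x₀ : M} (hx₀ : x₀ ∈ X) :
    (epochs E hm K b η s x₀).Returns φ lin fun l => l.length = s * K := by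
  induction s generalizing x₀ with
  | zero => exact (zero_mul K).symm
  | succ s ih =>
    refine (returns_true _).bind fun G _ =>
      (returns_epochSteps hm hX hD hlin hη0 hη1 x₀ G b K hx₀).bind fun r hr =>
      (ih hr.1).bind fun l hl => ?_
    change (r.1 ++ l).length = (s + 1) * K
    rw [List.length_append, hr.2, hl]
    ring

include hX hφ hD hD0 hL0 hlin hη0 hη1

/-- The minibatch size K² absorbs the drift K(ηD) from the reference point, so the expected gradient
error is at most LηD. Then 5/2 = 2 + 1/2, from 2Dη · LηD and (L/2)D²η². -/
theorem expect_frankWolfeStep_le {K : ℕ} (hK : 0 < K) {x₀ x : M} (hx₀ : x₀ ∈ X) (hx : x ∈ X)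
    (hdist : dist x₀ x ≤ K * (η * D)) :
    ((frankWolfeStep hm x₀ (fun i => riemGrad E (φ i) x₀) (K ^ 2) η x).expect φ lin fun x' =>
      η * fwGap E X (finiteSum φ) x + finiteSum φ x') ≤
      finiteSum φ x + 5 / 2 * L * D ^ 2 * η ^ 2 := by
  have hK' : (0 : ℝ) < K := Nat.cast_pos.2 hK
  have h1 := expect_gradientEstimate_norm_sq_le (lin := lin) hm hX hφ hx₀ hx (pow_pos hK 2)
  have h2 : (L * dist x₀ x) ^ 2 / (K ^ 2 : ℕ) ≤ (L * (η * D)) ^ 2 := by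
    rw [Nat.cast_pow, ← div_pow]
    refine pow_le_pow_left₀ (by positivity) ?_ 2
    rw [div_le_iff₀ hK', mul_assoc]
    exact mul_le_mul_of_nonneg_left (by linarith) hL0.le
  have h3 := expect_le_of_expect_sq_le (by positivity) (h1.trans h2)
  have hstep := fun g : TangentSpace 𝓘(ℝ, E) x => frankWolfe_progress hX hx hD hL0.le
    (isLSmoothOn_finiteSum hm hφ) ⟨hη0.le, hη1⟩ hlin g
  rw [frankWolfeStep, expect_bind]
  refine (expect_mono _ hstep).trans ?_
  have h4 := mul_le_mul_of_nonneg_left h3 (by positivity : 0 ≤ 2 * D * η)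
  rw [expect_add, expect_add, expect_const, expect_const, expect_const_mul]
  linarith

/-- Here `k` counts the steps still to be made, so K - k have been made, each of length at most ηD;
this is the invariant on the distance to `x₀`. -/
theorem expect_epochSteps_le {K : ℕ} {x₀ : M} (hx₀ : x₀ ∈ X) (k : ℕ) (hk : k ≤ K) {x : M}
    (hx : x ∈ X) (hdist : dist x₀ x ≤ (K - k) * (η * D)) :
    ((epochSteps hm x₀ (fun i => riemGrad E (φ i) x₀) (K ^ 2) η k x).expect φ lin fun r =>
      η * (r.1.map (fwGap E X (finiteSum φ))).sum + finiteSum φ r.2) ≤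
      finiteSum φ x + k * (5 / 2 * L * D ^ 2 * η ^ 2) := by
  induction k generalizing x with
  | zero => simp [epochSteps, expect]
  | succ k ih =>
    have hK : 0 < K := by omega
    have hηD : 0 < η * D := by positivity
    have h1 := expect_frankWolfeStep_le hm hX hφ hD0 hL0 hD hlin hη0 hη1 hK hx₀ hx
      (hdist.trans (mul_le_mul_of_nonneg_right (by
        have : (0 : ℝ) ≤ ((k + 1 : ℕ) : ℝ) := Nat.cast_nonneg _
        linarith) hηD.le))
    simp only [epochSteps, expect_bind, expect, List.map_cons, List.sum_cons]
    calc _ ≤ (frankWolfeStep hm x₀ (fun i => riemGrad E (φ i) x₀) (K ^ 2) η x).expect φ lin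
          fun x' => (η * fwGap E X (finiteSum φ) x + finiteSum φ x') +
            k * (5 / 2 * L * D ^ 2 * η ^ 2) := by
          refine (returns_frankWolfeStep hm hX hD hlin hη0 hη1 x₀ _ (K ^ 2) hx).expect_le
            fun x' hx' => ?_
          have h2 := ih (by omega) hx'.1 (by
            have := dist_triangle x₀ x x'
            push_cast at hdist
            linarith [hx'.2])
          simp only [mul_add, add_assoc]
          rw [expect_add, expect_const]
          linarith
      _ ≤ _ := by
          rw [expect_add, expect_const]
          push_cast
          linarith

theorem expect_epochs_le (K s : ℕ) {c : ℝ} (hc : ∀ x ∈ X, c ≤ finiteSum φ x) {x₀ : M}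
    (hx₀ : x₀ ∈ X) :
    ((epochs E hm K (K ^ 2) η s x₀).expect φ lin fun l =>
      η * (l.map (fwGap E X (finiteSum φ))).sum) ≤
      finiteSum φ x₀ - c + s * (K * (5 / 2 * L * D ^ 2 * η ^ 2)) := by
  induction s generalizing x₀ with
  | zero => simpa [epochs, expect] using hc x₀ hx₀
  | succ s ih =>
    -- An epoch starts at its own reference point, so the distance invariant holds trivially with
    -- all K steps remaining.
    have h1 := expect_epochSteps_le hm hX hφ hD0 hL0 hD hlin hη0 hη1 hx₀ K le_rfl hx₀
      (by simp)
    simp only [epochs, expect_bind, expect_componentGradients, expect, List.map_append,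
      List.sum_append, mul_add]
    calc _ ≤ (epochSteps hm x₀ (fun i => riemGrad E (φ i) x₀) (K ^ 2) η K x₀).expect φ lin
          fun r => (η * (r.1.map (fwGap E X (finiteSum φ))).sum + finiteSum φ r.2) +
            (- c + s * (K * (5 / 2 * L * D ^ 2 * η ^ 2))) := by
          refine (returns_epochSteps hm hX hD hlin hη0 hη1 x₀ _ (K ^ 2) K hx₀).expect_le
            fun r hr => ?_
          have h2 := ih hr.1
          rw [expect_add, expect_const]
          linarith
      _ ≤ _ := by
          rw [expect_add, expect_const]
          push_cast
          linarith

theorem expect_svrRfw_fwGap_le {K S : ℕ} (hK : 0 < K) (hS : 0 < S) {c : ℝ}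
    (hc : ∀ x ∈ X, c ≤ finiteSum φ x) {x₀ : M} (hx₀ : x₀ ∈ X) :
    (svrRfw E hm S K (K ^ 2) η x₀).expect φ lin (fwGap E X (finiteSum φ)) ≤
      (finiteSum φ x₀ - c) / (η * (K * S)) + 5 / 2 * L * D ^ 2 * η := by
  have hK' : (0 : ℝ) < K := Nat.cast_pos.2 hK
  have hS' : (0 : ℝ) < S := Nat.cast_pos.2 hS
  have h1 := expect_epochs_le hm hX hφ hD0 hL0 hD hlin hη0 hη1 K S hc hx₀
  rw [svrRfw, expect_bind]
  calc _ ≤ (epochs E hm K (K ^ 2) η S x₀).expect φ lin fun l =>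
        (η * (K * S))⁻¹ * (η * (l.map (fwGap E X (finiteSum φ))).sum) := by
        refine (returns_epochs hm hX hD hlin hη0 hη1 K (K ^ 2) S hx₀).expect_le fun l hl => ?_
        -- The list of iterates has length SK > 0, so the fallback output `x₀` never occurs and the
        -- final draw averages the gaps.
        have hpos : 0 < l.length := hl ▸ Nat.mul_pos hS hK
        rw [dif_pos hpos]
        refine le_of_eq ?_
        have h2 : ∑ i : Fin l.length, fwGap E X (finiteSum φ) (l.get i) =
            (l.map (fwGap E X (finiteSum φ))).sum := by
          rw [← List.sum_ofFn]
          congr 1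
          exact (List.ofFn_getElem_eq_map l _)
        simp only [expect, h2, hl, Nat.cast_mul]
        field_simp
    _ ≤ (η * (K * S))⁻¹ *
        (finiteSum φ x₀ - c + S * (K * (5 / 2 * L * D ^ 2 * η ^ 2))) := by
        rw [expect_const_mul]
        exact mul_le_mul_of_nonneg_left h1 (by positivity)
    _ = _ := by field_simp

end SvrRfwAnalysis

/-- The epoch length `⌈c⌉` and the number of epochs `⌈A² / (K ε²)⌉` keep the oracle costs within the
claimed bounds. -/
theorem oracle_cost_bounds {A c ε : ℝ} (hA : 0 < A) (hc : 1 ≤ c) (hε : 0 < ε) {K S : ℕ}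
    (hK : K = ⌈c⌉₊) (hS : S = ⌈A ^ 2 / (K * ε ^ 2)⌉₊) :
    0 < K ∧ 0 < S ∧ A / ε ≤ √(K * S) ∧
      (S : ℝ) * (c ^ 3 + K * (K : ℝ) ^ 2) ≤ 9 * (1 + A ^ 2) * (c ^ 3 + c ^ 2 / ε ^ 2) ∧
      (S : ℝ) * K ≤ 2 * c + A ^ 2 / ε ^ 2 := by
  have hK0 : 0 < K := by rw [hK]; exact Nat.ceil_pos.2 (by linarith)
  have hK' : (0 : ℝ) < K := Nat.cast_pos.2 hK0
  have hKc : c ≤ K := by rw [hK]; exact Nat.le_ceil c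
  have hK2 : (K : ℝ) ≤ 2 * c := by
    have := Nat.ceil_lt_add_one (by linarith : 0 ≤ c)
    rw [← hK] at this
    linarith
  have hq : 0 < A ^ 2 / (K * ε ^ 2) := by positivity
  have hS0 : 0 < S := by rw [hS]; exact Nat.ceil_pos.2 hq
  have hS1 : A ^ 2 / (K * ε ^ 2) ≤ S := by rw [hS]; exact Nat.le_ceil _
  have hS2 : (S : ℝ) ≤ A ^ 2 / (K * ε ^ 2) + 1 := by
    rw [hS]; exact (Nat.ceil_lt_add_one hq.le).le
  have hSK : (S : ℝ) * K ≤ A ^ 2 / ε ^ 2 + K := by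
    refine (mul_le_mul_of_nonneg_right hS2 hK'.le).trans (le_of_eq ?_)
    field_simp
  refine ⟨hK0, hS0, Real.le_sqrt_of_sq_le ?_, ?_, by linarith⟩
  · have h := mul_le_mul_of_nonneg_left hS1 hK'.le
    refine le_trans (le_of_eq ?_) h
    field_simp
  -- Here c³ plays the role of m, and K ≤ c + 1 ≤ 2c gives c³ + K³ ≤ 9c³.
  · have hcube : c ^ 3 + K * (K : ℝ) ^ 2 ≤ 9 * c ^ 3 := by
      have : (K : ℝ) ^ 3 ≤ (2 * c) ^ 3 := pow_le_pow_left₀ hK'.le hK2 3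
      linarith
    have hq2 : A ^ 2 / (K * ε ^ 2) ≤ A ^ 2 / (c * ε ^ 2) := by gcongr
    have hc0 : 0 < c := by linarith
    calc (S : ℝ) * (c ^ 3 + K * (K : ℝ) ^ 2) ≤ (A ^ 2 / (c * ε ^ 2) + 1) * (9 * c ^ 3) :=
          mul_le_mul (hS2.trans (by linarith)) hcube (by positivity) (by positivity)
      _ = 9 * (A ^ 2 * (c ^ 2 / ε ^ 2) + c ^ 3) := by field_simp
      _ ≤ _ := by
        have h1 : 0 ≤ c ^ 2 / ε ^ 2 := by positivity
        have h2 : 0 ≤ A ^ 2 * c ^ 3 := by positivity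
        linarith

theorem mainTheorem9 (L D Δ : ℝ) :
    ∃ C : ℝ, 0 < C ∧
    ∀ (m : ℕ) (hm : 0 < m) (ε : ℝ), 0 < ε →
    ∃ S : ℕ, 0 < S ∧
    ∀ (E : Type*) [NormedAddCommGroup E] [NormedSpace ℝ E] [FiniteDimensional ℝ E]
      (M : Type*) [MetricSpace M] [ChartedSpace E M] [IsManifold 𝓘(ℝ, E) ∞ M]
      [RiemannianBundle (fun x : M => TangentSpace 𝓘(ℝ, E) x)]
      [IsContMDiffRiemannianBundle 𝓘(ℝ, E) ∞ E (fun x : M => TangentSpace 𝓘(ℝ, E) x)]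
      [IsRiemannianManifold 𝓘(ℝ, E) M]
      (X : Set M) (φ : Fin m → M → ℝ) (lin : (x : M) → TangentSpace 𝓘(ℝ, E) x → M) (x₀ : M),
      IsCompact X → IsGeodesicallyConvex E X → (∀ i, IsLSmoothOn E X L (φ i)) →
      IsLinearOracle X lin → x₀ ∈ X →
      Metric.diam X ≤ D → (∀ x ∈ X, finiteSum φ x₀ - finiteSum φ x ≤ Δ) →
      let K : ℕ := ⌈(m : ℝ) ^ ((1 : ℝ) / 3)⌉₊
      let law : PMF (Outcome M) :=
        (svrRfw E hm S K (K ^ 2) (1 / √((K : ℝ) * S)) x₀).run φ lin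
      IsEpsAccurate E X (finiteSum φ) ε law ∧
      ∀ r ∈ law.support,
        (r.ifoCalls : ℝ) ≤ C * (m + (m : ℝ) ^ ((2 : ℝ) / 3) / ε ^ 2) ∧
        (r.rloCalls : ℝ) ≤ C * ((m : ℝ) ^ ((1 : ℝ) / 3) + 1 / ε ^ 2) ∧
        ((m : ℝ) ^ ((1 : ℝ) / 3) ≤ 1 / ε ^ 2 → (r.rloCalls : ℝ) ≤ C / ε ^ 2) := by
  -- The parameters are arbitrary reals; enlarging L and D to positive numbers keeps the hypotheses
  -- and makes A positive.
  set L' : ℝ := |L| + 1 with hL'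
  set D' : ℝ := |D| + 1 with hD'
  have hL0 : 0 < L' := by positivity
  have hD0 : 0 < D' := by positivity
  set A : ℝ := |Δ| + 5 / 2 * L' * D' ^ 2 with hA'
  have hA : 0 < A := by positivity
  refine ⟨9 * (1 + A ^ 2), by positivity, fun m hm ε hε => ?_⟩
  have hm1 : (1 : ℝ) ≤ m := Nat.one_le_cast.2 hm
  obtain ⟨c, hcdef⟩ : ∃ c : ℝ, c = (m : ℝ) ^ ((1 : ℝ) / 3) := ⟨_, rfl⟩
  have hc : 1 ≤ c := hcdef ▸ Real.one_le_rpow hm1 (by norm_num)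
  have hc2 : (m : ℝ) ^ ((2 : ℝ) / 3) = c ^ 2 := by
    rw [hcdef, ← Real.rpow_natCast, ← Real.rpow_mul (Nat.cast_nonneg m)]
    norm_num
  have hc3 : (m : ℝ) = c ^ 3 := by
    rw [hcdef, ← Real.rpow_natCast, ← Real.rpow_mul (Nat.cast_nonneg m)]
    norm_num
  -- The two `rfl` fix K = ⌈c⌉ and S = ⌈A²/(Kε²)⌉; this S involves only L, D, Δ, m and ε.
  obtain ⟨hK, hS, hsqrt, hifo, hrlo⟩ := oracle_cost_bounds hA hc hε rfl rfl
  refine ⟨_, hS, ?_⟩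
  intro E _ _ _ M _ _ _ _ _ _ X φ lin x₀ hcomp hX hφ hlin hx₀ hdiam hΔ
  rw [hc2, ← hcdef]
  generalize ⌈A ^ 2 / (⌈c⌉₊ * ε ^ 2)⌉₊ = S at *
  generalize ⌈c⌉₊ = K at *
  intro K' law
  have hr : 0 < √((K : ℝ) * S) := lt_of_lt_of_le (by positivity) hsqrt
  have hr1 : 1 ≤ √((K : ℝ) * S) := by
    rw [Real.one_le_sqrt]
    exact_mod_cast Nat.mul_pos hK hS
  have hη0 : 0 < 1 / √((K : ℝ) * S) := by positivity
  have hη1 : 1 / √((K : ℝ) * S) ≤ 1 := (div_le_one hr).2 hr1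
  refine ⟨⟨_, OracleProgram.hasSum_run _ _, ?_⟩, fun r hmem => ?_⟩
  · have h1 := expect_svrRfw_fwGap_le (lin := lin) hm hX
      (fun i => (hφ i).mono (by linarith [le_abs_self L] : L ≤ L')) hD0 hL0
      (fun p hp q hq => ((Metric.dist_le_diam_of_mem hcomp.isBounded hp hq).trans hdiam).trans
        (by linarith [le_abs_self D] : D ≤ D')) hlin hη0 hη1 hK hS
      -- With this lower bound for Φ on X, the initial excess is exactly Δ.
      (c := finiteSum φ x₀ - Δ) (fun x hx => by linarith [hΔ x hx]) hx₀
    refine h1.trans ?_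
    have hN : √((K : ℝ) * S) ^ 2 = K * S := Real.sq_sqrt (by positivity)
    generalize √((K : ℝ) * S) = ρ at hN hr hsqrt ⊢
    rw [← hN]
    -- For η = 1/ρ and KS = ρ², both error terms are multiples of 1/ρ.
    calc _ = (Δ + 5 / 2 * L' * D' ^ 2) / ρ := by field_simp; ring
      _ ≤ A / ρ := by
        gcongr
        linarith [le_abs_self Δ]
      _ ≤ ε := by
        rw [div_le_iff₀ hr]
        rwa [div_le_iff₀' hε] at hsqrt
  · obtain ⟨h1, h2⟩ := (hasCost_svrRfw hm S K (K ^ 2) _ x₀).eq_of_mem_support hmem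
    have h3 : 0 ≤ 1 / ε ^ 2 := by positivity
    have h4 : A ^ 2 / ε ^ 2 = A ^ 2 * (1 / ε ^ 2) := by ring
    have h5 : 0 ≤ A ^ 2 * (1 / ε ^ 2) := by positivity
    have h6 : 0 ≤ A ^ 2 * c := by positivity
    rw [h4] at hrlo
    rw [h1, h2, hc3]
    push_cast
    rw [hc3]
    refine ⟨hifo, ?_, fun hle => ?_⟩
    · linarith
    -- When c ≤ 1/ε², the rounding term 2c in the count SK is absorbed into 2/ε².
    · have h7 : 9 * (1 + A ^ 2) / ε ^ 2 = 9 * (1 / ε ^ 2) + 9 * (A ^ 2 * (1 / ε ^ 2)) := by ring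
      rw [h7]
      linarith
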